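/- For real $a,b$ let $T_{ab}:\mathbb{R}^2\to\mathbb{R}^2$ be the homeomorphism $T_{ab}(x,y)=(ax-y,\,x)$ if $x\ge 0$ and $T_{ab}(x,y)=(bx-y,\,x)$ if $x<0$. Since $T_{ab}$ maps rays from the origin to rays from the origin, it induces an orientation-preserving homeomorphism of the unit circle $S^1\subset\mathbb{R}^2$, $S_{ab}(u)=T_{ab}(u)/\|T_{ab}(u)\|$. Its rotation number is $r(S_{ab})=\lim_{n\to\infty}(\tilde S^{n}(t)-t)/n$ modulo $1$, where $\tilde S:\mathbb{R}\to\mathbb{R}$ is any lift of $S_{ab}$ with respect to $t\mapsto(\cos 2\pi t,\sin 2\pi t)$. Orbits of $T_{ab}$ are understood to be orbits of nonzero points. **Theorem.** Suppose that $a<2$ or $b<2$, and that the rotation number $r(S_{ab})$ is rational. Then $S_{ab}$ has a periodic orbit, and exactly one of the following three cases occurs. (i) $S_{ab}$ has exactly one periodic orbit. Then $T_{ab}$ has exactly one periodic orbit up to scaling by positive real numbers, and for every point $w\neq 0$ not on one of the positive multiples of this orbit, $\|T_{ab}^{n}(w)\|\to+\infty$ both as $n\to+\infty$ and as $n\to-\infty$.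 (ii) $S_{ab}$ has exactly two periodic orbits. Then $T_{ab}$ has no periodic orbits. The two periodic orbits of $S_{ab}$ can be named $P$ and $Q$ so that, for $w\ne 0$: if $w/\|w\|\in P$, then $\|T_{ab}^n(w)\|\to+\infty$ as $n\to+\infty$ and $\|T_{ab}^n(w)\|\to 0$ as $n\to-\infty$; if $w/\|w\|\in Q$, then $\|T_{ab}^n(w)\|\to 0$ as $n\to+\infty$ and $\|T_{ab}^n(w)\|\to+\infty$ as $n\to-\infty$; and if $w/\|w\|\notin P\cup Q$, then $\|T_{ab}^n(w)\|\to+\infty$ both as $n\to+\infty$ and as $n\to-\infty$. (iii) $S_{ab}$ has at least three periodic orbits. Then $T_{ab}$ has finite order, i.e. $T_{ab}^{k}=\mathrm{id}$ for some $k\ge 1$, and all orbits of $T_{ab}$ are periodic. -/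

import Mathlib

noncomputable section

namespace PlaneRec

/-- The two-valued slope `F_{ab}(x)`: `a` for `x ≥ 0` and `b` for `x < 0`. -/
def slope (a b x : ℝ) : ℝ := if 0 ≤ x then a else b

/-- The homeomorphism `T_{ab}(x, y) = (F_{ab}(x) x - y, x)` of the plane, as a bijection with its
inverse `(x, y) ↦ (y, F_{ab}(y) y - x)`. The point `(x, y)` of `ℝ²` is identified with
`x + y i`, so that the Euclidean norm is the modulus in `ℂ`. For `n : ℤ` the map `T a b ^ n` is
the `n`-th iterate. -/
def T (a b : ℝ) : Equiv.Perm ℂ where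
  toFun z := ⟨slope a b z.re * z.re - z.im, z.re⟩
  invFun z := ⟨z.im, slope a b z.im * z.im - z.re⟩
  left_inv z := by apply Complex.ext <;> simp
  right_inv z := by apply Complex.ext <;> simp

theorem T_ne_zero (a b : ℝ) {z : ℂ} (hz : z ≠ 0) : T a b z ≠ 0 := by
  have h0 : T a b 0 = 0 := by apply Complex.ext <;> simp [T]
  intro h
  exact hz ((T a b).injective (h.trans h0.symm))

/-- The circle map `S_{ab}(u) = T_{ab}(u) / ‖T_{ab}(u)‖`. -/
def S (a b : ℝ) (u : Circle) : Circle :=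
  ⟨T a b u / (‖T a b u‖ : ℂ), by
    have h : ‖T a b u‖ ≠ 0 := norm_ne_zero_iff.mpr (T_ne_zero a b u.coe_ne_zero)
    exact mem_sphere_zero_iff_norm.mpr (by simp [h])⟩

/-- `F` is a lift to `ℝ` of the circle map `f`, along the covering `x ↦ e^{2π i x}`. -/
def IsLift (f : Circle → Circle) (F : CircleDeg1Lift) : Prop :=
  Continuous F ∧ ∀ x : ℝ, Circle.exp (2 * Real.pi * F x) = f (Circle.exp (2 * Real.pi * x))

/-- `r` is the rotation number, modulo `1`, of the orientation-preserving circle homeomorphism `f`: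
`r = lim (F^n(x) - x) / n` for some lift `F` of `f`. -/
def HasRotationNumber (f : Circle → Circle) (r : ℝ) : Prop :=
  ∃ F : CircleDeg1Lift, IsLift f F ∧ F.translationNumber = r

/-- The periodic orbits of a map, as sets of points. -/
def periodicOrbits {α : Type*} (f : α → α) : Set (Set α) :=
  {O | ∃ x ∈ Function.periodicPts f, O = Set.range fun n : ℕ => f^[n] x}

/-- The points of the punctured plane lying over a set of points of the circle. -/
def rayPoints (O : Set Circle) : Set ℂ :=
  {w | ∃ u ∈ O, ∃ c : ℝ, 0 < c ∧ w = c • (u : ℂ)}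

end PlaneRec

end

/-! Write the rotation number as `p / q` in lowest terms. The periodic directions of `S` are the
rays that `T^q` maps to themselves; each is stretched by a multiplier `l > 0`, constant along its
orbit, and the theorem turns on which multipliers can occur. The reflection `swap` conjugates `T` to
its inverse, so it replaces `l` by `l⁻¹`.

The heart is `multiplier_mul_eq_one`: distinct periodic orbits have multipliers with product one.
Both branches of `T` are linear of determinant one, so the oriented area of two vectors changes only
when they lie on opposite sides of the vertical axis. During `q` steps, the arc between neighbouring
points of a periodic orbit sweeps each vertical half-axis exactly once. A ray of another orbit cuts
this arc in two. If one piece sweeps neither half-axis, its area is preserved and `l * m = 1`;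
otherwise the pieces sweep one half-axis each and give `l * m - 1` opposite signs, so it vanishes.

Three orbits thus all have multiplier one, and a rigidity argument (`T_iterate_fixed_of_compatible`,
`T_iterate_fixed_of_exists`) gives `T^q = 1`. For two orbits `l ≠ 1`, since otherwise `T^q = 1` and
two finite orbits would cover the circle. For one orbit the reflection gives `l = l⁻¹`. On the
remaining rays, consecutive images under `T^q` eventually span a constant nonzero area while their
angle tends to zero, so the norms diverge (`tendsto_norm_of_not_periodic`). The condition on `a, b`
enters only for `q = 1`. -/

noncomputable section

namespace PlaneRec

variable {a b : ℝ}

/-! ### Reversibility, homogeneity and oriented area for the plane map. -/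

/-- The oriented area of the parallelogram spanned by two vectors. -/
def cross (v w : ℂ) : ℝ := v.re * w.im - v.im * w.re

/-- The reflection `(x, y) ↦ (y, x)`. -/
def swap (z : ℂ) : ℂ := ⟨z.im, z.re⟩

@[simp] theorem swap_swap (z : ℂ) : swap (swap z) = z := rfl

theorem norm_swap (z : ℂ) : ‖swap z‖ = ‖z‖ := by
  rw [← sq_eq_sq₀ (norm_nonneg _) (norm_nonneg _), Complex.sq_norm, Complex.sq_norm]
  simp [swap, Complex.normSq_apply, add_comm]

theorem swap_smul (c : ℝ) (z : ℂ) : swap (c • z) = c • swap z := by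
  apply Complex.ext <;> simp [swap]

theorem swap_ne_zero {z : ℂ} (h : z ≠ 0) : swap z ≠ 0 := by
  rw [← norm_ne_zero_iff, norm_swap]; exact norm_ne_zero_iff.mpr h

@[simp] theorem T_re (z : ℂ) : (T a b z).re = slope a b z.re * z.re - z.im := rfl
@[simp] theorem T_im (z : ℂ) : (T a b z).im = z.re := rfl

/-- Reversibility: every backward statement will follow from a forward one applied to the reflected
vector. -/
theorem T_swap_T_swap (z : ℂ) : T a b (swap (T a b (swap z))) = z := by
  apply Complex.ext <;> simp [swap]

theorem T_inv_apply (z : ℂ) : (T a b)⁻¹ z = swap (T a b (swap z)) :=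
  (T a b).injective <| by rw [T_swap_T_swap, Equiv.Perm.coe_inv, Equiv.apply_symm_apply]

theorem T_inv_pow_apply (n : ℕ) (z : ℂ) :
    ((T a b)⁻¹ ^ n) z = swap ((T a b)^[n] (swap z)) := by
  induction n generalizing z with
  | zero => simp
  | succ n ih =>
    rw [pow_succ', Equiv.Perm.mul_apply, ih, T_inv_apply, Function.iterate_succ_apply', swap_swap]

theorem T_iterate_swap {n : ℕ} {z w : ℂ} (h : (T a b)^[n] z = w) :
    (T a b)^[n] (swap w) = swap z := by
  have h1 := T_inv_pow_apply (a := a) (b := b) n w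
  have h2 : ((T a b)⁻¹ ^ n) w = z := by
    rw [← h, Equiv.Perm.iterate_eq_pow, inv_pow, Equiv.Perm.coe_inv, Equiv.symm_apply_apply]
  rw [h2] at h1
  rw [h1, swap_swap]

theorem slope_mul_pos {c : ℝ} (hc : 0 < c) (x : ℝ) : slope a b (c * x) = slope a b x := by
  simp [slope, mul_nonneg_iff_of_pos_left hc]

theorem T_smul {c : ℝ} (hc : 0 < c) (z : ℂ) : T a b (c • z) = c • T a b z := by
  apply Complex.ext <;> simp [slope_mul_pos hc]; ring

theorem T_iterate_smul {c : ℝ} (hc : 0 < c) (n : ℕ) (z : ℂ) :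
    (T a b)^[n] (c • z) = c • (T a b)^[n] z := by
  induction n generalizing z with
  | zero => rfl
  | succ n ih => rw [Function.iterate_succ_apply, T_smul hc, ih, Function.iterate_succ_apply]

@[simp] theorem T_zero : T a b 0 = 0 := by apply Complex.ext <;> simp

theorem T_iterate_zero (n : ℕ) : (T a b)^[n] 0 = 0 := Function.iterate_fixed T_zero n

theorem T_iterate_ne_zero (n : ℕ) {z : ℂ} (hz : z ≠ 0) : (T a b)^[n] z ≠ 0 := by
  intro h
  exact hz (((T a b).injective.iterate n) (h.trans (T_iterate_zero n).symm))

theorem T_iterate_smul_eq {n : ℕ} {l : ℝ} (hl : 0 < l) {z : ℂ} (h : (T a b)^[n] z = l • z) (m : ℕ) :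
    (T a b)^[n] ((T a b)^[m] z) = l • (T a b)^[m] z := by
  rw [← Function.iterate_add_apply, add_comm, Function.iterate_add_apply, h, T_iterate_smul hl]

theorem T_iterate_mul_smul_eq {n : ℕ} {l : ℝ} (hl : 0 < l) {z : ℂ} (h : (T a b)^[n] z = l • z)
    (m : ℕ) : (T a b)^[n * m] z = l ^ m • z := by
  induction m with
  | zero => simp
  | succ m ih =>
    rw [Nat.mul_succ, add_comm, Function.iterate_add_apply, ih, T_iterate_smul (pow_pos hl m), h,
      smul_smul, pow_succ]

/-- The change of the oriented area under one application of `T`. -/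
def jump (a b : ℝ) (v w : ℂ) : ℝ := (slope a b v.re - slope a b w.re) * (v.re * w.re)

/-- Each branch has determinant one, so the area changes only through the difference of the two
slopes. -/
theorem cross_T (v w : ℂ) : cross (T a b v) (T a b w) = cross v w + jump a b v w := by
  simp only [cross, jump, T_re, T_im]; ring

theorem cross_T_iterate (n : ℕ) (v w : ℂ) :
    cross ((T a b)^[n] v) ((T a b)^[n] w) =
      cross v w + ∑ j ∈ Finset.range n, jump a b ((T a b)^[j] v) ((T a b)^[j] w) := by
  induction n with
  | zero => simp
  | succ n ih =>
    rw [Function.iterate_succ_apply', Function.iterate_succ_apply', cross_T, ih,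
      Finset.sum_range_succ, add_assoc]

theorem jump_eq_zero {v w : ℂ} (h : 0 ≤ v.re * w.re) : jump a b v w = 0 := by
  rcases h.eq_or_lt with h | h
  · simp [jump, ← h]
  · rcases pos_and_pos_or_neg_and_neg_of_mul_pos h with ⟨h1, h2⟩ | ⟨h1, h2⟩
    · simp [jump, slope, h1.le, h2.le]
    · simp [jump, slope, not_le.mpr h1, not_le.mpr h2]

theorem jump_of_nonneg_of_nonpos {v w : ℂ} (hv : 0 ≤ v.re) (hw : w.re ≤ 0) :
    jump a b v w = (a - b) * (v.re * w.re) := by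
  rcases hw.eq_or_lt with h | h
  · simp [jump, h]
  · simp [jump, slope, hv, not_le.mpr h]

theorem jump_of_nonpos_of_nonneg {v w : ℂ} (hv : v.re ≤ 0) (hw : 0 ≤ w.re) :
    jump a b v w = (b - a) * (v.re * w.re) := by
  rcases hv.eq_or_lt with h | h
  · simp [jump, h]
  · simp [jump, slope, hw, not_le.mpr h]

theorem cross_smul_smul (c d : ℝ) (v w : ℂ) : cross (c • v) (d • w) = c * d * cross v w := by
  simp [cross]; ring

/-! ### Rigidity: when fixed vectors force an iterate of `T` to be the identity. -/

/-- The images of `d` under the linear maps that `T` applies along the orbit of `v`. -/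
def tangent (a b : ℝ) (v d : ℂ) : ℕ → ℂ
  | 0 => d
  | n + 1 => ⟨slope a b ((T a b)^[n] v).re * (tangent a b v d n).re - (tangent a b v d n).im,
      (tangent a b v d n).re⟩

theorem tangent_neg (v d : ℂ) (n : ℕ) : tangent a b v (-d) n = -tangent a b v d n := by
  induction n with
  | zero => rfl
  | succ n ih => apply Complex.ext <;> simp [tangent, ih]; ring

/-- `T^n` is linear on the cone of vectors whose orbits stay on the same sides as that of `v`. The
cone may be taken closed because the slope is irrelevant where it multiplies zero. -/
theorem T_iterate_add_smul {v d : ℂ} {s : ℝ} {n : ℕ}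
    (h : ∀ j < n, ((T a b)^[j] v).re ≠ 0 ∧
      0 ≤ ((T a b)^[j] v).re * (((T a b)^[j] v).re + s * (tangent a b v d j).re)) :
    (T a b)^[n] (v + s • d) = (T a b)^[n] v + s • tangent a b v d n := by
  induction n with
  | zero => rfl
  | succ n ih =>
    rw [Function.iterate_succ_apply', Function.iterate_succ_apply',
      ih fun j hj => h j (hj.trans n.lt_succ_self)]
    obtain ⟨h0, h1⟩ := h n n.lt_succ_self
    set x := ((T a b)^[n] v) with hx
    set y := tangent a b v d n with hy
    have key : slope a b (x.re + s * y.re) * (x.re + s * y.re)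
        = slope a b x.re * (x.re + s * y.re) := by
      rcases h1.eq_or_lt with h1 | h1
      · have : x.re + s * y.re = 0 := by
          rcases mul_eq_zero.mp h1.symm with h | h
          · exact absurd h h0
          · exact h
        simp [this]
      · rcases pos_and_pos_or_neg_and_neg_of_mul_pos h1 with ⟨h1, h2⟩ | ⟨h1, h2⟩
        · simp [slope, h1.le, h2.le]
        · simp [slope, not_le.mpr h1, not_le.mpr h2]
    apply Complex.ext
    · simp only [T_re, Complex.add_re, Complex.smul_re, Complex.add_im, Complex.smul_im, tangent,
        ← hx, ← hy, smul_eq_mul, key]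
      ring
    · simp [tangent, ← hx, ← hy]

/-- Moving from `v` in a direction `d` that does not stay in the linearity cone of `v`, one leaves
the cone through a vector whose orbit meets the vertical axis. -/
theorem exists_exit {v d : ℂ} {n : ℕ} (hv : ∀ j < n, ((T a b)^[j] v).re ≠ 0)
    (hd : ∃ j < n, ((T a b)^[j] v).re * (tangent a b v d j).re < 0) :
    ∃ s : ℝ, 0 < s ∧ (T a b)^[n] (v + s • d) = (T a b)^[n] v + s • tangent a b v d n ∧
      ∃ j < n, ((T a b)^[j] (v + s • d)).re = 0 := by
  classical
  set J := (Finset.range n).filter fun j => ((T a b)^[j] v).re * (tangent a b v d j).re < 0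
    with hJ
  have hne : J.Nonempty := by
    obtain ⟨j, hj, h⟩ := hd
    exact ⟨j, by simp [hJ, hj, h]⟩
  -- The coordinate `i` reaches zero first. The parameter `-x / y` is written as `x ^ 2 / -(x * y)`
  -- to make its positivity visible.
  obtain ⟨i, hi, hmin⟩ := Finset.exists_min_image J
    (fun j => ((T a b)^[j] v).re ^ 2 / -(((T a b)^[j] v).re * (tangent a b v d j).re)) hne
  obtain ⟨hin, hineg⟩ : i < n ∧ ((T a b)^[i] v).re * (tangent a b v d i).re < 0 := by
    simpa [hJ] using hi
  set s := ((T a b)^[i] v).re ^ 2 / -(((T a b)^[i] v).re * (tangent a b v d i).re) with hs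
  have hspos : 0 < s := div_pos (sq_pos_of_ne_zero (hv i hin)) (by linarith)
  have hall : ∀ j < n, ((T a b)^[j] v).re ≠ 0 ∧
      0 ≤ ((T a b)^[j] v).re * (((T a b)^[j] v).re + s * (tangent a b v d j).re) := by
    intro j hj
    refine ⟨hv j hj, ?_⟩
    by_cases hneg : ((T a b)^[j] v).re * (tangent a b v d j).re < 0
    · have h1 := hmin j (by simp [hJ, hj, hneg])
      rw [le_div_iff₀ (by linarith)] at h1
      linarith
    · have := mul_nonneg hspos.le (not_lt.mp hneg)
      nlinarith [sq_nonneg ((T a b)^[j] v).re]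
  refine ⟨s, hspos, T_iterate_add_smul hall, i, hin, ?_⟩
  rw [T_iterate_add_smul fun j hj => hall j (hj.trans hin)]
  have h1 : s * -(((T a b)^[i] v).re * (tangent a b v d i).re) = ((T a b)^[i] v).re ^ 2 :=
    div_mul_cancel₀ _ (by linarith)
  have h2 := hv i hin
  apply mul_left_cancel₀ h2
  simp only [Complex.add_re, Complex.smul_re, smul_eq_mul]
  linarith

theorem T_iterate_tangent {v w : ℂ} {n : ℕ}
    (h : ∀ j < n, 0 < ((T a b)^[j] v).re * ((T a b)^[j] w).re) {j : ℕ} (hj : j ≤ n) :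
    tangent a b v (w - v) j = (T a b)^[j] w - (T a b)^[j] v := by
  induction j with
  | zero => rfl
  | succ j ih =>
    have ih := ih (by omega)
    have h1 := h j (by omega)
    have h2 : slope a b ((T a b)^[j] v).re = slope a b ((T a b)^[j] w).re := by
      rcases pos_and_pos_or_neg_and_neg_of_mul_pos h1 with ⟨h1, h2⟩ | ⟨h1, h2⟩
      · simp [slope, h1.le, h2.le]
      · simp [slope, not_le.mpr h1, not_le.mpr h2]
    rw [Function.iterate_succ_apply', Function.iterate_succ_apply']
    apply Complex.ext
    · simp [tangent, ih, h2]; ring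
    · simp [tangent, ih]

/-- If an iterate of `T` fixes both vertical unit vectors, it fixes every vector whose orbit meets
the vertical axis. -/
theorem T_iterate_fixed_of_re_eq_zero {q : ℕ} (h1 : (T a b)^[q] ⟨0, 1⟩ = ⟨0, 1⟩)
    (h2 : (T a b)^[q] ⟨0, -1⟩ = ⟨0, -1⟩) {w : ℂ} {j : ℕ} (hw : ((T a b)^[j] w).re = 0) :
    (T a b)^[q] w = w := by
  have key : (T a b)^[q] ((T a b)^[j] w) = (T a b)^[j] w := by
    set z := (T a b)^[j] w
    rcases lt_trichotomy z.im 0 with h | h | h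
    · have hz : z = (-z.im) • (⟨0, -1⟩ : ℂ) := by apply Complex.ext <;> simp [hw]
      rw [hz, T_iterate_smul (by linarith), h2]
    · have hz : z = 0 := by apply Complex.ext <;> simp [hw, h]
      rw [hz, T_iterate_zero]
    · have hz : z = z.im • (⟨0, 1⟩ : ℂ) := by apply Complex.ext <;> simp [hw]
      rw [hz, T_iterate_smul h, h1]
  rw [← Function.iterate_add_apply, add_comm, Function.iterate_add_apply] at key
  exact (T a b).injective.iterate j key

/-- One fixed orbit meeting the axis makes both vertical unit vectors fixed, hence every vector
whose orbit meets the axis. Any other vector lies between two such vectors on a segment where `T^q`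
is affine. -/
theorem T_iterate_fixed_of_exists {q : ℕ} (hq : 2 ≤ q) {w : ℂ} (hw0 : w ≠ 0)
    (hw : (T a b)^[q] w = w) {j : ℕ} (hj : ((T a b)^[j] w).re = 0) (v : ℂ) :
    (T a b)^[q] v = v := by
  have hTu : T a b ⟨0, 1⟩ = ⟨-1, 0⟩ := by apply Complex.ext <;> simp
  have hTd : T a b ⟨0, -1⟩ = ⟨1, 0⟩ := by apply Complex.ext <;> simp
  have step : ∀ z, (T a b)^[q] z = z → (T a b)^[q] (T a b z) = T a b z := by
    intro z hz
    rw [← Function.iterate_succ_apply, Function.iterate_succ_apply', hz]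
  -- `T` sends `(0, 1)` to `(-1, 0)`, the reflection of `(0, -1)`, so reversibility carries the
  -- fixed point across.
  have hud : (T a b)^[q] ⟨0, 1⟩ = ⟨0, 1⟩ → (T a b)^[q] ⟨0, -1⟩ = ⟨0, -1⟩ := by
    intro h
    have := step _ h
    rw [hTu] at this
    exact T_iterate_swap this
  have hdu : (T a b)^[q] ⟨0, -1⟩ = ⟨0, -1⟩ → (T a b)^[q] ⟨0, 1⟩ = ⟨0, 1⟩ := by
    intro h
    have := step _ h
    rw [hTd] at this
    exact T_iterate_swap this
  have hz : (T a b)^[q] ((T a b)^[j] w) = (T a b)^[j] w := by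
    rw [← Function.iterate_add_apply, add_comm, Function.iterate_add_apply, hw]
  have hz0 := T_iterate_ne_zero (a := a) (b := b) j hw0
  have hboth : (T a b)^[q] ⟨0, 1⟩ = ⟨0, 1⟩ ∧ (T a b)^[q] ⟨0, -1⟩ = ⟨0, -1⟩ := by
    set z := (T a b)^[j] w
    rcases lt_trichotomy z.im 0 with h | h | h
    · have hz' : (⟨0, -1⟩ : ℂ) = (-z.im)⁻¹ • z := by
        apply Complex.ext
        · simp [hj]
        · simp [h.ne]
      have : (T a b)^[q] ⟨0, -1⟩ = ⟨0, -1⟩ := by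
        rw [hz', T_iterate_smul (inv_pos.mpr (by linarith)), hz]
      exact ⟨hdu this, this⟩
    · exact absurd (by apply Complex.ext <;> simp [hj, h]) hz0
    · have hz' : (⟨0, 1⟩ : ℂ) = (z.im)⁻¹ • z := by
        apply Complex.ext
        · simp [hj]
        · simp [h.ne']
      have : (T a b)^[q] ⟨0, 1⟩ = ⟨0, 1⟩ := by
        rw [hz', T_iterate_smul (inv_pos.mpr h), hz]
      exact ⟨this, hud this⟩
  by_cases hv : ∃ j < q, ((T a b)^[j] v).re = 0
  · obtain ⟨j, -, hj⟩ := hv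
    exact T_iterate_fixed_of_re_eq_zero hboth.1 hboth.2 hj
  push Not at hv
  have h0 : v.re ≠ 0 := hv 0 (by omega)
  have h1 : (T a b v).re ≠ 0 := hv 1 (by omega)
  -- Along `d` the real part grows away from zero at time 0 and shrinks towards zero at time 1, so
  -- both `d` and `-d` leave the cone. Two times are available because `2 ≤ q`.
  set d : ℂ := ⟨v.re, slope a b v.re * v.re + (T a b v).re⟩ with hd
  have hd0 : (tangent a b v d 0).re = v.re := rfl
  have hd1 : (tangent a b v d 1).re = -(T a b v).re := by
    simp only [tangent, hd, Function.iterate_zero, id]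
    ring
  obtain ⟨s, hs, hsd, i, -, hi⟩ := exists_exit hv (d := d) ⟨1, by omega, by
    rw [hd1, Function.iterate_one]; nlinarith [sq_pos_of_ne_zero h1]⟩
  obtain ⟨r, hr, hrd, k, -, hk⟩ := exists_exit hv (d := -d) ⟨0, by omega, by
    rw [tangent_neg, Complex.neg_re, hd0, Function.iterate_zero, id]
    nlinarith [sq_pos_of_ne_zero h0]⟩
  rw [T_iterate_fixed_of_re_eq_zero hboth.1 hboth.2 hi] at hsd
  rw [T_iterate_fixed_of_re_eq_zero hboth.1 hboth.2 hk, tangent_neg] at hrd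
  have hsr : s + r ≠ 0 := by positivity
  have : (s + r) • (T a b)^[q] v = (s + r) • v := by
    linear_combination (norm := module) (-r) • hsd + (-s) • hrd
  exact smul_right_injective _ hsr this

/-- Two independent fixed vectors of an iterate of `T` whose orbits always lie on the same side of
the vertical axis force that iterate to be the identity. -/
theorem T_iterate_fixed_of_compatible {q : ℕ} (hq : 2 ≤ q) {v w : ℂ} (hvw : cross v w ≠ 0)
    (hv : (T a b)^[q] v = v) (hw : (T a b)^[q] w = w)
    (h : ∀ j < q, 0 ≤ ((T a b)^[j] v).re * ((T a b)^[j] w).re) (z : ℂ) :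
    (T a b)^[q] z = z := by
  have hv0 : v ≠ 0 := by rintro rfl; simp [cross] at hvw
  have hw0 : w ≠ 0 := by rintro rfl; simp [cross] at hvw
  by_cases hvz : ∃ j < q, ((T a b)^[j] v).re = 0
  · obtain ⟨j, -, hj⟩ := hvz
    exact T_iterate_fixed_of_exists hq hv0 hv hj z
  by_cases hwz : ∃ j < q, ((T a b)^[j] w).re = 0
  · obtain ⟨j, -, hj⟩ := hwz
    exact T_iterate_fixed_of_exists hq hw0 hw hj z
  push Not at hvz hwz
  have hpos : ∀ j < q, 0 < ((T a b)^[j] v).re * ((T a b)^[j] w).re := fun j hj =>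
    lt_of_le_of_ne (h j hj) (mul_ne_zero (hvz j hj) (hwz j hj)).symm
  -- If some image of `w` is nearer to the axis than that of `v`, the ray from `v` through `w`
  -- leaves their common cone. As `T^q` is linear there, the exit vector is fixed too, and its orbit
  -- meets the axis.
  have main : ∀ v w : ℂ, cross v w ≠ 0 → (T a b)^[q] v = v → (T a b)^[q] w = w →
      (∀ j < q, 0 < ((T a b)^[j] v).re * ((T a b)^[j] w).re) →
      (∃ j < q, ((T a b)^[j] v).re * (((T a b)^[j] w).re - ((T a b)^[j] v).re) < 0) →
      (T a b)^[q] z = z := by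
    rintro v w hvw hv hw hpos ⟨j, hj, hneg⟩
    obtain ⟨s, hs, hsd, i, -, hi⟩ := exists_exit (v := v) (d := w - v) (n := q)
      (fun j hj h0 => by have := hpos j hj; rw [h0, zero_mul] at this; exact this.false)
      ⟨j, hj, by rw [T_iterate_tangent hpos hj.le]; simpa using hneg⟩
    rw [T_iterate_tangent hpos le_rfl, hv, hw] at hsd
    refine T_iterate_fixed_of_exists hq ?_ hsd hi z
    intro h0
    apply hvw
    have hre : v.re + s * (w.re - v.re) = 0 := by simpa using congrArg Complex.re h0
    have him : v.im + s * (w.im - v.im) = 0 := by simpa using congrArg Complex.im h0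
    have h1 : s * cross v w = 0 := by
      simp only [cross]; linear_combination v.re * him - v.im * hre
    exact (mul_eq_zero.mp h1).resolve_left hs.ne'
  by_cases h1 : ∃ j < q, ((T a b)^[j] v).re * (((T a b)^[j] w).re - ((T a b)^[j] v).re) < 0
  · exact main v w hvw hv hw hpos h1
  by_cases h2 : ∃ j < q, ((T a b)^[j] w).re * (((T a b)^[j] v).re - ((T a b)^[j] w).re) < 0
  · refine main w v ?_ hw hv (fun j hj => by rw [mul_comm]; exact hpos j hj) h2
    intro h0; apply hvw; simp only [cross] at h0 ⊢; linarith
  push Not at h1 h2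
  -- With no exit either way the real parts agree at all times; times 0 and 1 already determine the
  -- vector.
  have heq : ∀ j < q, ((T a b)^[j] v).re = ((T a b)^[j] w).re := by
    intro j hj
    have := h1 j hj
    have := h2 j hj
    have : (((T a b)^[j] w).re - ((T a b)^[j] v).re) ^ 2 = 0 :=
      le_antisymm (by nlinarith) (sq_nonneg _)
    have := pow_eq_zero_iff (two_ne_zero) |>.mp this
    linarith
  have e0 : v.re = w.re := heq 0 (by omega)
  have e1 : (T a b v).re = (T a b w).re := heq 1 (by omega)
  simp only [T_re, e0] at e1
  exact absurd (by simp only [cross, e0]; linear_combination w.re * e1) hvw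

theorem T_add_smul (z w : ℂ) (r s : ℝ) : T a a (r • z + s • w) = r • T a a z + s • T a a w := by
  apply Complex.ext
  · simp [slope]; ring
  · simp

theorem T_iterate_fixed_of_eq {q : ℕ} {v w : ℂ} (hvw : cross v w ≠ 0)
    (hv : (T a a)^[q] v = v) (hw : (T a a)^[q] w = w) (z : ℂ) : (T a a)^[q] z = z := by
  have hlin : ∀ (n : ℕ) (r s : ℝ), (T a a)^[n] (r • v + s • w)
      = r • (T a a)^[n] v + s • (T a a)^[n] w := by
    intro n r s
    induction n with
    | zero => rfl
    | succ n ih => simp only [Function.iterate_succ_apply', ih, T_add_smul]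
  have hz : z = (cross z w / cross v w) • v + (cross v z / cross v w) • w := by
    apply Complex.ext
    · simp only [Complex.add_re, Complex.smul_re, smul_eq_mul]
      field_simp
      simp only [cross]; ring
    · simp only [Complex.add_im, Complex.smul_im, smul_eq_mul]
      field_simp
      simp only [cross]; ring
  rw [hz, hlin, hv, hw]

end PlaneRec
end

/-! ### The circle map, its lift, and the relation to the plane map. -/

noncomputable section

namespace PlaneRec

variable {a b : ℝ}

theorem T_circle_ne_zero (n : ℕ) (u : Circle) : (T a b)^[n] (u : ℂ) ≠ 0 :=
  T_iterate_ne_zero n u.coe_ne_zero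

theorem T_iterate_circle (n : ℕ) (u : Circle) :
    (T a b)^[n] (u : ℂ) = ‖(T a b)^[n] (u : ℂ)‖ • (((S a b)^[n] u : Circle) : ℂ) := by
  induction n with
  | zero => rw [Function.iterate_zero, Function.iterate_zero, id, id, Circle.norm_coe, one_smul]
  | succ n ih =>
    have hpos : 0 < ‖(T a b)^[n] (u : ℂ)‖ := norm_pos_iff.mpr (T_circle_ne_zero n u)
    have hS : ∀ v : Circle, T a b (v : ℂ) = ‖T a b (v : ℂ)‖ • ((S a b v : Circle) : ℂ) := by
      intro v
      have h : (‖T a b (v : ℂ)‖ : ℂ) ≠ 0 := by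
        exact_mod_cast norm_ne_zero_iff.mpr (T_ne_zero a b v.coe_ne_zero)
      rw [Complex.real_smul]
      change _ = _ * (T a b (v : ℂ) / _)
      rw [mul_div_cancel₀ _ h]
    have hT : (T a b)^[n + 1] (u : ℂ) = (‖(T a b)^[n] (u : ℂ)‖ *
        ‖T a b ((S a b)^[n] u : Circle)‖) • (((S a b)^[n + 1] u : Circle) : ℂ) := by
      rw [Function.iterate_succ_apply', ih, T_smul hpos, hS, smul_smul,
        Function.iterate_succ_apply', ← ih, norm_smul, norm_norm, Circle.norm_coe, mul_one]
    have hn := congrArg norm hT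
    rw [norm_smul, Circle.norm_coe, mul_one, Real.norm_of_nonneg (by positivity)] at hn
    rw [hn, hT]

theorem circle_eq_of_smul_eq {u v : Circle} {c d : ℝ} (hc : 0 < c) (hd : 0 < d)
    (h : c • (u : ℂ) = d • (v : ℂ)) : u = v := by
  have h1 := congrArg norm h
  rw [norm_smul, norm_smul, Circle.norm_coe, Circle.norm_coe, mul_one, mul_one,
    Real.norm_of_nonneg hc.le, Real.norm_of_nonneg hd.le] at h1
  rw [h1] at h
  exact Circle.ext (smul_right_injective ℂ hd.ne' h)

theorem S_iterate_eq_of_smul {n : ℕ} {u v : Circle} {c : ℝ} (hc : 0 < c)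
    (h : (T a b)^[n] (u : ℂ) = c • (v : ℂ)) : (S a b)^[n] u = v := by
  rw [T_iterate_circle] at h
  exact circle_eq_of_smul_eq (norm_pos_iff.mpr (T_circle_ne_zero n u)) hc h

theorem S_injective : Function.Injective (S a b) := by
  intro u v h
  have hu := T_iterate_circle (a := a) (b := b) 1 u
  have hv := T_iterate_circle (a := a) (b := b) 1 v
  simp only [Function.iterate_one, h] at hu hv
  have hup : 0 < ‖T a b (u : ℂ)‖ := norm_pos_iff.mpr (T_circle_ne_zero 1 u)
  have hvp : 0 < ‖T a b (v : ℂ)‖ := norm_pos_iff.mpr (T_circle_ne_zero 1 v)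
  refine circle_eq_of_smul_eq hvp hup ((T a b).injective ?_)
  rw [T_smul hvp, T_smul hup, hu, hv, norm_smul, norm_smul, norm_norm, norm_norm, Circle.norm_coe,
    mul_one, mul_one, smul_smul, smul_smul, mul_comm]

/-- The covering `t ↦ e^{2π i t}` of the circle. -/
def ray (t : ℝ) : Circle := Circle.exp (2 * Real.pi * t)

theorem ray_re (t : ℝ) : (ray t : ℂ).re = Real.cos (2 * Real.pi * t) := by
  rw [ray, Circle.coe_exp, Complex.exp_ofReal_mul_I_re]

theorem ray_im (t : ℝ) : (ray t : ℂ).im = Real.sin (2 * Real.pi * t) := by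
  rw [ray, Circle.coe_exp, Complex.exp_ofReal_mul_I_im]

theorem ray_surjective (u : Circle) : ∃ t, ray t = u := by
  obtain ⟨x, hx⟩ := Circle.exp_surjective u
  refine ⟨x / (2 * Real.pi), ?_⟩
  rw [ray, mul_div_cancel₀ _ Real.two_pi_pos.ne', hx]

theorem ray_eq_ray {s t : ℝ} : ray s = ray t ↔ ∃ m : ℤ, s = t + m := by
  rw [ray, ray, Circle.exp_eq_exp]
  refine exists_congr fun m => ?_
  have := Real.pi_pos
  constructor
  · intro h
    apply mul_left_cancel₀ Real.two_pi_pos.ne'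
    linarith
  · rintro rfl; ring

theorem ray_add_int (t : ℝ) (m : ℤ) : ray (t + m) = ray t := ray_eq_ray.mpr ⟨m, rfl⟩

theorem cross_ray (s t : ℝ) :
    cross (ray s) (ray t) = Real.sin (2 * Real.pi * (t - s)) := by
  rw [cross, ray_re, ray_re, ray_im, ray_im, mul_sub, Real.sin_sub]; ring

variable {F : CircleDeg1Lift}

theorem S_iterate_ray (hF : IsLift (S a b) F) (n : ℕ) (t : ℝ) :
    (S a b)^[n] (ray t) = ray ((F ^ n) t) := by
  induction n with
  | zero => simp
  | succ n ih =>
    rw [Function.iterate_succ_apply', ih, pow_succ', CircleDeg1Lift.mul_apply, ray, ray, hF.2]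

theorem T_iterate_ray (hF : IsLift (S a b) F) (n : ℕ) (t : ℝ) :
    ∃ r : ℝ, 0 < r ∧ (T a b)^[n] (ray t : ℂ) = r • (ray ((F ^ n) t) : ℂ) :=
  ⟨_, norm_pos_iff.mpr (T_circle_ne_zero n _), by rw [← S_iterate_ray hF, ← T_iterate_circle]⟩

theorem lift_strictMono (hF : IsLift (S a b) F) : StrictMono F := by
  rw [CircleDeg1Lift.strictMono_iff_injective]
  intro s t h
  have h1 : S a b (ray s) = S a b (ray t) := by
    have := S_iterate_ray hF 1 s
    have := S_iterate_ray hF 1 t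
    simp_all
  obtain ⟨m, rfl⟩ := ray_eq_ray.mp (S_injective h1)
  rw [CircleDeg1Lift.map_add_int] at h
  have : (m : ℝ) = 0 := by linarith
  rw [this, add_zero]

theorem lift_pow_strictMono (hF : IsLift (S a b) F) (n : ℕ) : StrictMono (F ^ n) := by
  rw [CircleDeg1Lift.coe_pow]; exact (lift_strictMono hF).iterate n

/-! ### Half-planes described by integer parts of angles. -/

section HalfPlanes

/-- These floors count the passages of the lower and of the upper vertical half-axis. They differ by
one in the right half-plane and agree in the left one. -/
theorem floor_quarter (t : ℝ) :
    ⌊t + 1 / 4⌋ = ⌊t + -1 / 4⌋ + 1 ∨ ⌊t + 1 / 4⌋ = ⌊t + -1 / 4⌋ := by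
  have h1 := Int.floor_le (t + -1 / 4)
  have h2 := Int.lt_floor_add_one (t + -1 / 4)
  by_cases h : (⌊t + -1 / 4⌋ : ℝ) + 1 ≤ t + 1 / 4
  · left
    rw [Int.floor_eq_iff]; push_cast
    exact ⟨h, by linarith⟩
  · right
    rw [Int.floor_eq_iff]
    exact ⟨by linarith, by linarith⟩

theorem ray_re_nonneg {t : ℝ} (h : ⌊t + 1 / 4⌋ = ⌊t + -1 / 4⌋ + 1) : 0 ≤ (ray t : ℂ).re := by
  have h1 := Int.floor_le (t + 1 / 4)
  have h2 := Int.lt_floor_add_one (t + -1 / 4)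
  have h3 : (⌊t + 1 / 4⌋ : ℝ) = ⌊t + -1 / 4⌋ + 1 := by exact_mod_cast h
  rw [ray_re, ← Real.cos_sub_int_mul_two_pi _ ⌊t + 1 / 4⌋]
  have := Real.pi_pos
  apply Real.cos_nonneg_of_neg_pi_div_two_le_of_le <;> nlinarith

theorem ray_re_nonpos {t : ℝ} (h : ⌊t + 1 / 4⌋ = ⌊t + -1 / 4⌋) : (ray t : ℂ).re ≤ 0 := by
  have h1 := Int.floor_le (t + -1 / 4)
  have h2 := Int.lt_floor_add_one (t + 1 / 4)
  have h3 : (⌊t + 1 / 4⌋ : ℝ) = ⌊t + -1 / 4⌋ := by exact_mod_cast h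
  rw [ray_re, ← Real.cos_sub_int_mul_two_pi _ ⌊t + 1 / 4⌋]
  have := Real.pi_pos
  apply Real.cos_nonpos_of_pi_div_two_le_of_le <;> nlinarith

variable {s t : ℝ}

theorem ray_re_mul_nonneg (hp : ⌊s + 1 / 4⌋ = ⌊t + 1 / 4⌋) (hm : ⌊s + -1 / 4⌋ = ⌊t + -1 / 4⌋) :
    0 ≤ (ray s : ℂ).re * (ray t : ℂ).re := by
  rcases floor_quarter s with h | h
  · exact mul_nonneg (ray_re_nonneg h) (ray_re_nonneg (by omega))
  · exact mul_nonneg_of_nonpos_of_nonpos (ray_re_nonpos h) (ray_re_nonpos (by omega))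

theorem sub_lt_half (hp : ⌊s + 1 / 4⌋ = ⌊t + 1 / 4⌋) (hm : ⌊s + -1 / 4⌋ = ⌊t + -1 / 4⌋) :
    t - s < 1 / 2 := by
  have h1 := Int.floor_le (s + 1 / 4)
  have h2 := Int.floor_le (s + -1 / 4)
  have h3 := Int.lt_floor_add_one (t + 1 / 4)
  have h4 := Int.lt_floor_add_one (t + -1 / 4)
  have hp' : (⌊s + 1 / 4⌋ : ℝ) = ⌊t + 1 / 4⌋ := by exact_mod_cast hp
  have hm' : (⌊s + -1 / 4⌋ : ℝ) = ⌊t + -1 / 4⌋ := by exact_mod_cast hm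
  rcases floor_quarter s with h | h
  · have : (⌊s + 1 / 4⌋ : ℝ) = ⌊s + -1 / 4⌋ + 1 := by exact_mod_cast h
    linarith
  · have : (⌊s + 1 / 4⌋ : ℝ) = ⌊s + -1 / 4⌋ := by exact_mod_cast h
    linarith

theorem cross_ray_pos (h0 : s < t) (h1 : t - s < 1 / 2) : 0 < cross (ray s) (ray t) := by
  rw [cross_ray]
  have := Real.pi_pos
  apply Real.sin_pos_of_pos_of_lt_pi <;> nlinarith

end HalfPlanes

/-! ### Counting passages of a half-axis along an orbit. -/

/-- The number of integer translates of `-c`, counted from a fixed origin, that the first `q`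
iterates of `t` have passed. -/
def hits (F : CircleDeg1Lift) (q : ℕ) (c t : ℝ) : ℤ := ∑ j ∈ Finset.range q, ⌊(F ^ j) t + c⌋

section Hits

variable {q : ℕ} {p : ℤ} {c s t : ℝ}

theorem hits_mono : Monotone (hits F q c) := fun _ _ h =>
  Finset.sum_le_sum fun j _ => Int.floor_mono (add_le_add_left ((F ^ j).mono h) c)

theorem hits_add_int (m : ℤ) : hits F q c (t + m) = hits F q c t + q * m := by
  simp only [hits, CircleDeg1Lift.map_add_int]
  simp only [add_right_comm _ (m : ℝ) c, Int.floor_add_intCast, Finset.sum_add_distrib]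
  simp

/-- Passing to `F t` drops the term `j = 0` and adds the term `j = q`, which is the dropped one
shifted by `p`. -/
theorem hits_map (ht : (F ^ q) t = t + p) : hits F q c (F t) = hits F q c t + p := by
  have h1 : hits F q c (F t) = ∑ j ∈ Finset.range q, ⌊(F ^ (j + 1)) t + c⌋ := rfl
  have h2 := Finset.sum_range_succ (fun j => ⌊(F ^ j) t + c⌋) q
  rw [Finset.sum_range_succ', ht, pow_zero, CircleDeg1Lift.coe_one, id,
    add_right_comm, Int.floor_add_intCast] at h2
  rw [h1, hits]; linarith

theorem pow_map_eq (ht : (F ^ q) t = t + p) (k : ℕ) : (F ^ q) ((F ^ k) t) = (F ^ k) t + p := by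
  rw [← CircleDeg1Lift.mul_apply, ← pow_add, add_comm, pow_add, CircleDeg1Lift.mul_apply, ht,
    CircleDeg1Lift.map_add_int]

theorem hits_pow_map (ht : (F ^ q) t = t + p) (k : ℕ) :
    hits F q c ((F ^ k) t) = hits F q c t + k * p := by
  induction k with
  | zero => simp
  | succ k ih =>
    rw [pow_succ', CircleDeg1Lift.mul_apply, hits_map (pow_map_eq ht k), ih]
    push_cast; ring

/-- The sums are ordered term by term, so equal sums have equal terms. -/
theorem floor_eq_of_hits_eq (hst : s ≤ t) (h : hits F q c s = hits F q c t) {j : ℕ} (hj : j < q) :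
    ⌊(F ^ j) s + c⌋ = ⌊(F ^ j) t + c⌋ :=
  (Finset.sum_eq_sum_iff_of_le fun j _ =>
    Int.floor_mono (add_le_add_left ((F ^ j).mono hst) c)).mp h j (Finset.mem_range.mpr hj)

theorem exists_floor_succ_of_hits (hst : s ≤ t) (h : hits F q c t = hits F q c s + 1) :
    ∃ i < q, ⌊(F ^ i) t + c⌋ = ⌊(F ^ i) s + c⌋ + 1 ∧
      ∀ j < q, j ≠ i → ⌊(F ^ j) s + c⌋ = ⌊(F ^ j) t + c⌋ := by
  classical
  set g : ℕ → ℤ := fun j => ⌊(F ^ j) t + c⌋ - ⌊(F ^ j) s + c⌋ with hg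
  have hg0 : ∀ j, 0 ≤ g j := fun j =>
    sub_nonneg.mpr (Int.floor_mono (add_le_add_left ((F ^ j).mono hst) c))
  have hsum : ∑ j ∈ Finset.range q, g j = 1 := by
    simp only [hg, Finset.sum_sub_distrib]
    simp only [hits] at h
    omega
  obtain ⟨i, hi, hi0⟩ : ∃ i ∈ Finset.range q, g i ≠ 0 := by
    by_contra! h0
    rw [Finset.sum_eq_zero h0] at hsum
    exact zero_ne_one hsum
  rw [← Finset.add_sum_erase _ _ hi] at hsum
  have h1 : 0 ≤ ∑ j ∈ (Finset.range q).erase i, g j := Finset.sum_nonneg fun j _ => hg0 j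
  have h2 := hg0 i
  have h3 : ∑ j ∈ (Finset.range q).erase i, g j = 0 := by omega
  have h4 : g i = 1 := by omega
  refine ⟨i, Finset.mem_range.mp hi, by simp only [hg] at h4; omega, fun j hj hji => ?_⟩
  have := (Finset.sum_eq_zero_iff_of_nonneg fun j _ => hg0 j).mp h3 j
    (Finset.mem_erase.mpr ⟨hji, Finset.mem_range.mpr hj⟩)
  simp only [hg] at this; omega

end Hits

/-! ### Area balance for an arc between two periodic rays. -/

section Arcs

variable {q : ℕ} {p : ℤ} {s t l m : ℝ}

theorem re_mul_re_nonneg (hF : IsLift (S a b) F) {j : ℕ}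
    (hp : ⌊(F ^ j) s + 1 / 4⌋ = ⌊(F ^ j) t + 1 / 4⌋)
    (hm : ⌊(F ^ j) s + -1 / 4⌋ = ⌊(F ^ j) t + -1 / 4⌋) :
    0 ≤ ((T a b)^[j] (ray s : ℂ)).re * ((T a b)^[j] (ray t : ℂ)).re := by
  obtain ⟨r, hr, e⟩ := T_iterate_ray hF j s
  obtain ⟨r', hr', e'⟩ := T_iterate_ray hF j t
  rw [e, e', Complex.smul_re, Complex.smul_re, smul_eq_mul, smul_eq_mul, mul_mul_mul_comm]
  exact mul_nonneg (mul_pos hr hr').le (ray_re_mul_nonneg hp hm)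

theorem cross_iterate_pos (hF : IsLift (S a b) F) (hst : s < t) {j : ℕ}
    (hp : ⌊(F ^ j) s + 1 / 4⌋ = ⌊(F ^ j) t + 1 / 4⌋)
    (hm : ⌊(F ^ j) s + -1 / 4⌋ = ⌊(F ^ j) t + -1 / 4⌋) :
    0 < cross ((T a b)^[j] (ray s : ℂ)) ((T a b)^[j] (ray t : ℂ)) := by
  obtain ⟨r, hr, e⟩ := T_iterate_ray hF j s
  obtain ⟨r', hr', e'⟩ := T_iterate_ray hF j t
  rw [e, e', cross_smul_smul]
  exact mul_pos (mul_pos hr hr')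
    (cross_ray_pos (lift_pow_strictMono hF j hst) (sub_lt_half hp hm))

theorem re_nonneg_of_floor (hF : IsLift (S a b) F) {j : ℕ}
    (h : ⌊(F ^ j) s + 1 / 4⌋ = ⌊(F ^ j) s + -1 / 4⌋ + 1) :
    0 ≤ ((T a b)^[j] (ray s : ℂ)).re := by
  obtain ⟨r, hr, e⟩ := T_iterate_ray hF j s
  rw [e, Complex.smul_re]
  exact mul_nonneg hr.le (ray_re_nonneg h)

theorem re_nonpos_of_floor (hF : IsLift (S a b) F) {j : ℕ}
    (h : ⌊(F ^ j) s + 1 / 4⌋ = ⌊(F ^ j) s + -1 / 4⌋) :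
    ((T a b)^[j] (ray s : ℂ)).re ≤ 0 := by
  obtain ⟨r, hr, e⟩ := T_iterate_ray hF j s
  rw [e, Complex.smul_re]
  exact mul_nonpos_of_nonneg_of_nonpos hr.le (ray_re_nonpos h)

theorem arc_compatible (hF : IsLift (S a b) F) (hq : 0 < q) (hst : s < t)
    (hp : hits F q (1 / 4) s = hits F q (1 / 4) t)
    (hm : hits F q (-1 / 4) s = hits F q (-1 / 4) t) :
    0 < cross (ray s) (ray t) ∧
      ∀ j < q, 0 ≤ ((T a b)^[j] (ray s : ℂ)).re * ((T a b)^[j] (ray t : ℂ)).re :=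
  ⟨cross_iterate_pos hF hst (j := 0) (floor_eq_of_hits_eq hst.le hp hq)
      (floor_eq_of_hits_eq hst.le hm hq),
    fun _ hj => re_mul_re_nonneg hF (floor_eq_of_hits_eq hst.le hp hj)
      (floor_eq_of_hits_eq hst.le hm hj)⟩

theorem cross_mul_eq {v w : ℂ} (hv : (T a b)^[q] v = l • v) (hw : (T a b)^[q] w = m • w) :
    l * m * cross v w =
      cross v w + ∑ j ∈ Finset.range q, jump a b ((T a b)^[j] v) ((T a b)^[j] w) := by
  rw [← cross_T_iterate, hv, hw, cross_smul_smul]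

theorem mul_eq_one_of_compatible {v w : ℂ} (hv : (T a b)^[q] v = l • v)
    (hw : (T a b)^[q] w = m • w) (hvw : cross v w ≠ 0)
    (h : ∀ j < q, 0 ≤ ((T a b)^[j] v).re * ((T a b)^[j] w).re) : l * m = 1 := by
  have := cross_mul_eq hv hw
  rw [Finset.sum_eq_zero fun j hj => jump_eq_zero (h j (Finset.mem_range.mp hj)), add_zero] at this
  exact mul_right_cancel₀ hvw (this.trans (one_mul _).symm)

/-- An arc whose orbit crosses the vertical axis only once spans a positively oriented pair. -/
theorem cross_pos_of_single_jump (hF : IsLift (S a b) F) (hq : 2 ≤ q) (hst : s < t)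
    (hl : 0 < l) (hm : 0 < m)
    (hs : (T a b)^[q] (ray s : ℂ) = l • (ray s : ℂ))
    (ht : (T a b)^[q] (ray t : ℂ) = m • (ray t : ℂ)) {i : ℕ} (hi : i < q)
    (h : ∀ j < q, j ≠ i → ⌊(F ^ j) s + 1 / 4⌋ = ⌊(F ^ j) t + 1 / 4⌋ ∧
      ⌊(F ^ j) s + -1 / 4⌋ = ⌊(F ^ j) t + -1 / 4⌋) :
    0 < cross (ray s) (ray t) ∧ (l * m - 1) * cross (ray s) (ray t) =
      jump a b ((T a b)^[i] (ray s : ℂ)) ((T a b)^[i] (ray t : ℂ)) := by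
  have hjump : ∀ j < q, j ≠ i → jump a b ((T a b)^[j] (ray s : ℂ)) ((T a b)^[j] (ray t : ℂ)) = 0 :=
    fun j hj hji => jump_eq_zero (re_mul_re_nonneg hF (h j hj hji).1 (h j hj hji).2)
  have htot := cross_mul_eq hs ht
  rw [Finset.sum_eq_single_of_mem i (Finset.mem_range.mpr hi)
    fun j hj => hjump j (Finset.mem_range.mp hj)] at htot
  refine ⟨?_, by linarith⟩
  -- The area is constant up to time `i`, and afterwards equals its value at time `q`, which is `l *
  -- m` times the initial one. Its sign can thus be read off at any other time `j`, when both images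
  -- share a half-plane.
  obtain ⟨j, hj, hji⟩ : ∃ j < q, j ≠ i := by
    by_cases h0 : i = 0
    · exact ⟨1, by omega, by omega⟩
    · exact ⟨0, by omega, by omega⟩
  have hpos := cross_iterate_pos hF hst (h j hj hji).1 (h j hj hji).2
  rw [cross_T_iterate] at hpos
  rcases lt_or_gt_of_ne hji with hlt | hgt
  · rwa [Finset.sum_eq_zero, add_zero] at hpos
    intro k hk
    have := Finset.mem_range.mp hk
    exact hjump k (by omega) (by omega)
  · rw [Finset.sum_eq_single_of_mem i (Finset.mem_range.mpr hgt), ← htot] at hpos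
    · exact pos_of_mul_pos_right hpos (mul_pos hl hm).le
    · intro k hk
      have := Finset.mem_range.mp hk
      exact hjump k (by omega)

/-- An arc whose orbit crosses the upper vertical half-axis once and the lower one never. -/
theorem arc_cross_upper (hF : IsLift (S a b) F) (hq : 2 ≤ q) (hst : s < t)
    (hl : 0 < l) (hm : 0 < m)
    (hs : (T a b)^[q] (ray s : ℂ) = l • (ray s : ℂ))
    (ht : (T a b)^[q] (ray t : ℂ) = m • (ray t : ℂ))
    (h1 : hits F q (1 / 4) s = hits F q (1 / 4) t)
    (h2 : hits F q (-1 / 4) t = hits F q (-1 / 4) s + 1) :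
    0 < cross (ray s) (ray t) ∧ ∃ i,
      ((T a b)^[i] (ray s : ℂ)).re * ((T a b)^[i] (ray t : ℂ)).re ≤ 0 ∧
      (l * m - 1) * cross (ray s) (ray t) =
        (a - b) * (((T a b)^[i] (ray s : ℂ)).re * ((T a b)^[i] (ray t : ℂ)).re) := by
  obtain ⟨i, hi, hi1, hi2⟩ := exists_floor_succ_of_hits hst.le h2
  have hf := fun j hj => floor_eq_of_hits_eq (j := j) hst.le h1 hj
  obtain ⟨hpos, hj⟩ := cross_pos_of_single_jump hF hq hst hl hm hs ht hi
    fun j hj hji => ⟨hf j hj, hi2 j hj hji⟩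
  have hfi := hf i hi
  have hx : 0 ≤ ((T a b)^[i] (ray s : ℂ)).re := re_nonneg_of_floor hF (by
    rcases floor_quarter ((F ^ i) s) with h | h <;> rcases floor_quarter ((F ^ i) t) with h' | h' <;>
      omega)
  have hz : ((T a b)^[i] (ray t : ℂ)).re ≤ 0 := re_nonpos_of_floor hF (by
    rcases floor_quarter ((F ^ i) s) with h | h <;> rcases floor_quarter ((F ^ i) t) with h' | h' <;>
      omega)
  exact ⟨hpos, i, mul_nonpos_of_nonneg_of_nonpos hx hz,
    hj.trans (jump_of_nonneg_of_nonpos hx hz)⟩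

/-- An arc whose orbit crosses the lower vertical half-axis once and the upper one never. -/
theorem arc_cross_lower (hF : IsLift (S a b) F) (hq : 2 ≤ q) (hst : s < t)
    (hl : 0 < l) (hm : 0 < m)
    (hs : (T a b)^[q] (ray s : ℂ) = l • (ray s : ℂ))
    (ht : (T a b)^[q] (ray t : ℂ) = m • (ray t : ℂ))
    (h1 : hits F q (1 / 4) t = hits F q (1 / 4) s + 1)
    (h2 : hits F q (-1 / 4) s = hits F q (-1 / 4) t) :
    0 < cross (ray s) (ray t) ∧ ∃ i,
      ((T a b)^[i] (ray s : ℂ)).re * ((T a b)^[i] (ray t : ℂ)).re ≤ 0 ∧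
      (l * m - 1) * cross (ray s) (ray t) =
        (b - a) * (((T a b)^[i] (ray s : ℂ)).re * ((T a b)^[i] (ray t : ℂ)).re) := by
  obtain ⟨i, hi, hi1, hi2⟩ := exists_floor_succ_of_hits hst.le h1
  have hf := fun j hj => floor_eq_of_hits_eq (j := j) hst.le h2 hj
  obtain ⟨hpos, hj⟩ := cross_pos_of_single_jump hF hq hst hl hm hs ht hi
    fun j hj hji => ⟨hi2 j hj hji, hf j hj⟩
  have hfi := hf i hi
  have hx : ((T a b)^[i] (ray s : ℂ)).re ≤ 0 := re_nonpos_of_floor hF (by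
    rcases floor_quarter ((F ^ i) s) with h | h <;> rcases floor_quarter ((F ^ i) t) with h' | h' <;>
      omega)
  have hz : 0 ≤ ((T a b)^[i] (ray t : ℂ)).re := re_nonneg_of_floor hF (by
    rcases floor_quarter ((F ^ i) s) with h | h <;> rcases floor_quarter ((F ^ i) t) with h' | h' <;>
      omega)
  exact ⟨hpos, i, mul_nonpos_of_nonpos_of_nonneg hx hz,
    hj.trans (jump_of_nonpos_of_nonneg hx hz)⟩

end Arcs

end PlaneRec
end

/-! ### Distinct periodic orbits have inverse multipliers. -/

noncomputable section

namespace PlaneRec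

variable {a b : ℝ} {F : CircleDeg1Lift} {q : ℕ} {p : ℤ} {s t l m : ℝ}

theorem T_iterate_S_iterate {u : Circle} (hl : 0 < l) (hu : (T a b)^[q] (u : ℂ) = l • (u : ℂ))
    (k : ℕ) : (T a b)^[q] (((S a b)^[k] u : Circle) : ℂ) = l • (((S a b)^[k] u : Circle) : ℂ) := by
  have h := T_iterate_smul_eq hl hu k
  have hr : 0 < ‖(T a b)^[k] (u : ℂ)‖ := norm_pos_iff.mpr (T_circle_ne_zero k u)
  rw [T_iterate_circle k u, T_iterate_smul hr, smul_comm] at h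
  exact smul_right_injective ℂ hr.ne' h

/-- Two interleaved periodic orbits of the circle map have inverse multipliers. -/
theorem multiplier_mul_eq_one_of_lift (hF : IsLift (S a b) F) (hq : 2 ≤ q) {k : ℕ} {n : ℤ}
    (hkn : k * p - n * q = 1) (hs : (F ^ q) s = s + p) (hst : s < t) (hts : t < (F ^ k) s - n)
    (hl : 0 < l) (hm : 0 < m) (hls : (T a b)^[q] (ray s : ℂ) = l • (ray s : ℂ))
    (hmt : (T a b)^[q] (ray t : ℂ) = m • (ray t : ℂ)) :
    l * m = 1 ∧ (l = 1 → m = 1 → ∀ z, (T a b)^[q] z = z) := by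
  set s' := (F ^ k) s - n with hs'
  -- The count grows by `k * p - n * q = 1`: between `s` and `s'` each half-axis is passed once.
  have hhit : ∀ c, hits F q c s' = hits F q c s + 1 := by
    intro c
    have h1 := hits_add_int (F := F) (q := q) (c := c) (t := (F ^ k) s) (-n)
    rw [hits_pow_map hs, Int.cast_neg, ← sub_eq_add_neg, ← hs'] at h1
    rw [h1]; linarith
  have hls' : (T a b)^[q] (ray s' : ℂ) = l • (ray s' : ℂ) := by
    have : ray s' = (S a b)^[k] (ray s) := by
      rw [S_iterate_ray hF, hs', sub_eq_add_neg, ← Int.cast_neg, ray_add_int]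
    rw [this]
    exact T_iterate_S_iterate hl hls k
  have hc : ∀ c, (hits F q c s = hits F q c t ∧ hits F q c s' = hits F q c t + 1) ∨
      (hits F q c t = hits F q c s + 1 ∧ hits F q c t = hits F q c s') := by
    intro c
    have h1 := hits_mono (F := F) (q := q) (c := c) hst.le
    have h2 := hits_mono (F := F) (q := q) (c := c) hts.le
    have h3 := hhit c
    omega
  have compat : ∀ {v w : ℂ} {l m : ℝ}, (T a b)^[q] v = l • v → (T a b)^[q] w = m • w →
      (0 < cross v w ∧ ∀ j < q, 0 ≤ ((T a b)^[j] v).re * ((T a b)^[j] w).re) →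
      l * m = 1 ∧ (l = 1 → m = 1 → ∀ z, (T a b)^[q] z = z) := by
    rintro v w l m hv hw ⟨h1, h2⟩
    refine ⟨mul_eq_one_of_compatible hv hw h1.ne' h2, ?_⟩
    rintro rfl rfl
    rw [one_smul] at hv hw
    exact T_iterate_fixed_of_compatible hq h1.ne' hv hw h2
  -- Multiplying the two balances gives `(l * m - 1) ^ 2 * X * Y = -(a - b) ^ 2 * x * y ≤ 0`.
  have mixed : ∀ {X Y x y : ℝ}, 0 < X → 0 < Y → x ≤ 0 → y ≤ 0 →
      (l * m - 1) * X = (a - b) * x → (m * l - 1) * Y = (b - a) * y → l * m = 1 := by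
    intro X Y x y hX hY hx hy h1 h2
    have e : (l * m - 1) * ((l * m - 1) * X * Y) ≤ 0 := by
      have e1 : (l * m - 1) * ((l * m - 1) * X * Y) = -((a - b) ^ 2 * (x * y)) := by
        linear_combination ((l * m - 1) * Y) * h1 + (a - b) * x * h2
      rw [e1, neg_nonpos]
      exact mul_nonneg (sq_nonneg _) (mul_nonneg_of_nonpos_of_nonpos hx hy)
    have e2 : (l * m - 1) ^ 2 = 0 := by
      refine le_antisymm ?_ (sq_nonneg _)
      have : (l * m - 1) ^ 2 * (X * Y) ≤ 0 := by linarith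
      exact nonpos_of_mul_nonpos_left this (mul_pos hX hY)
    linarith [pow_eq_zero_iff two_ne_zero |>.mp e2]
  -- With both multipliers one the jump vanishes: either `a = b` and `T` is linear, or one of the
  -- orbits meets the axis.
  have rigid : ∀ {i : ℕ} {c : ℝ}, 0 < cross (ray s) (ray t) →
      (l * m - 1) * cross (ray s) (ray t) =
        c * (((T a b)^[i] (ray s : ℂ)).re * ((T a b)^[i] (ray t : ℂ)).re) →
      (c = 0 → a = b) → l = 1 → m = 1 → ∀ z, (T a b)^[q] z = z := by
    rintro i c hpos he hcab rfl rfl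
    rw [one_smul] at hls hmt
    rw [one_mul, sub_self, zero_mul, eq_comm, mul_eq_zero, mul_eq_zero] at he
    rcases he with h | h | h
    · obtain rfl := hcab h
      exact T_iterate_fixed_of_eq hpos.ne' hls hmt
    · exact T_iterate_fixed_of_exists hq (ray s).coe_ne_zero hls h
    · exact T_iterate_fixed_of_exists hq (ray t).coe_ne_zero hmt h
  rcases hc (1 / 4) with ⟨h1, h1'⟩ | ⟨h1, h1'⟩ <;> rcases hc (-1 / 4) with ⟨h2, h2'⟩ | ⟨h2, h2'⟩
  · exact compat hls hmt (arc_compatible hF (by omega) hst h1 h2)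
  · obtain ⟨hX, i, hx, e1⟩ := arc_cross_upper hF hq hst hl hm hls hmt h1 h2
    obtain ⟨hY, j, hy, e2⟩ := arc_cross_lower hF hq hts hm hl hmt hls' h1' h2'
    exact ⟨mixed hX hY hx hy e1 e2, rigid hX e1 sub_eq_zero.mp⟩
  · obtain ⟨hX, i, hx, e1⟩ := arc_cross_lower hF hq hst hl hm hls hmt h1 h2
    obtain ⟨hY, j, hy, e2⟩ := arc_cross_upper hF hq hts hm hl hmt hls' h1' h2'
    refine ⟨?_, rigid hX e1 fun h => (sub_eq_zero.mp h).symm⟩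
    rw [mul_comm] at e1 e2
    have := mixed (X := cross (ray t) (ray s')) (Y := cross (ray s) (ray t)) hY hX hy hx
      (by linarith [mul_comm l m]) (by linarith [mul_comm l m])
    exact this
  · have := compat hmt hls' (arc_compatible hF (by omega) hts h1' h2')
    exact ⟨by rw [mul_comm]; exact this.1, fun h h' => this.2 h' h⟩

/-- The multiple of `q` added to `u` makes the coefficient nonnegative, so that it can be an
exponent of `F`. -/
theorem exists_bezout (hq : 0 < q) (hpq : IsCoprime p q) : ∃ (k : ℕ) (n : ℤ), k * p - n * q = 1 := by
  obtain ⟨u, v, h⟩ := hpq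
  have h0 : 0 ≤ u + |u| * q := by
    have h1 : (1 : ℤ) ≤ q := by exact_mod_cast hq
    nlinarith [neg_abs_le u, abs_nonneg u]
  refine ⟨(u + |u| * q).toNat, |u| * p - v, ?_⟩
  rw [Int.toNat_of_nonneg h0]
  linear_combination h

/-- Distinct periodic orbits of the circle map have inverse multipliers. -/
theorem multiplier_mul_eq_one (hF : IsLift (S a b) F) (hq : 2 ≤ q) (hpq : IsCoprime p q)
    {u v : Circle} (hu : ∀ t, ray t = u → (F ^ q) t = t + p)
    (huv : ∀ n, (S a b)^[n] u ≠ v) (hl : 0 < l) (hm : 0 < m)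
    (hlu : (T a b)^[q] (u : ℂ) = l • (u : ℂ)) (hmv : (T a b)^[q] (v : ℂ) = m • (v : ℂ)) :
    l * m = 1 ∧ (l = 1 → m = 1 → ∀ z, (T a b)^[q] z = z) := by
  classical
  obtain ⟨k, n, hkn⟩ := exists_bezout (by omega) hpq
  obtain ⟨s₀, hs₀⟩ := ray_surjective u
  obtain ⟨t, rfl⟩ := ray_surjective v
  set s := s₀ + ⌊t - s₀⌋ with hs
  have hsu : ray s = u := by rw [hs, ray_add_int, hs₀]
  have hst : s ≤ t := by linarith [Int.floor_le (t - s₀)]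
  -- `g` runs through lifts of the orbit of `u`; each step raises the count by one, so `g`
  -- eventually passes `t`, and the first passage brackets `t`.
  set g : ℕ → ℝ := fun i => (fun x => (F ^ k) x - n)^[i] s with hg
  have hgs : ∀ i, g (i + 1) = (F ^ k) (g i) - n := fun i => Function.iterate_succ_apply' _ i s
  have hray : ∀ i, ray (g i) = (S a b)^[k * i] u := by
    intro i
    induction i with
    | zero => simpa [hg] using hsu
    | succ i ih =>
      rw [hgs, sub_eq_add_neg, ← Int.cast_neg, ray_add_int, ← S_iterate_ray hF, ih,
        Nat.mul_succ, add_comm, Function.iterate_add_apply]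
  have hK : ∀ i, (F ^ q) (g i) = g i + p := by
    intro i
    induction i with
    | zero => exact hu s hsu
    | succ i ih => rw [hgs, CircleDeg1Lift.map_sub_int, pow_map_eq ih]; ring
  have hh : ∀ i : ℕ, hits F q 0 (g i) = hits F q 0 s + i := by
    intro i
    induction i with
    | zero => simp [hg]
    | succ i ih =>
      have h1 := hits_add_int (F := F) (q := q) (c := 0) (t := (F ^ k) (g i)) (-n)
      rw [hits_pow_map (hK i), Int.cast_neg, ← sub_eq_add_neg, ← hgs, ih] at h1
      rw [h1]; push_cast; linarith
  have hex : ∃ i, t < g i := by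
    by_contra! h
    have h1 := hits_mono (F := F) (q := q) (c := 0) (h ((hits F q 0 t - hits F q 0 s).toNat + 1))
    rw [hh] at h1
    push_cast at h1
    have := Int.self_le_toNat (hits F q 0 t - hits F q 0 s)
    omega
  obtain ⟨i, hi⟩ : ∃ i, Nat.find hex = i + 1 := by
    refine Nat.exists_eq_succ_of_ne_zero fun h0 => ?_
    have := Nat.find_spec hex
    rw [h0] at this
    exact absurd this (not_lt.mpr hst)
  have h1 : t < (F ^ k) (g i) - n := by
    rw [← hgs, ← hi]; exact Nat.find_spec hex
  have h2 : g i ≤ t := not_lt.mp (Nat.find_min hex (by omega))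
  have h3 : g i < t := lt_of_le_of_ne h2 fun h => huv (k * i) (by rw [← hray, h])
  refine multiplier_mul_eq_one_of_lift hF hq hkn (hK i) h3 h1 hl hm ?_ hmv
  rw [hray]
  exact T_iterate_S_iterate hl hlu _

/-- A period `n` with shift `m` has `m / n = p / q`, so `(F ^ q)^n` shifts `t` by `n * p`; by
monotonicity `F ^ q` then shifts it by exactly `p`. -/
theorem lift_pow_eq_of_periodic (hF : IsLift (S a b) F) (hq : 0 < q)
    (hτ : F.translationNumber = p / q) {u : Circle} (hu : u ∈ Function.periodicPts (S a b))
    (ht : ray t = u) : (F ^ q) t = t + p := by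
  obtain ⟨n, hn, hnu⟩ := hu
  have h1 : (S a b)^[n] u = u := hnu
  rw [← ht, S_iterate_ray hF, ray_eq_ray] at h1
  obtain ⟨m, hm⟩ := h1
  have h2 := F.translationNumber_of_map_pow_eq_add_int hm hn
  rw [hτ, div_eq_div_iff (by positivity) (by positivity)] at h2
  rw [← (F ^ q).iterate_pos_eq_iff hn, ← CircleDeg1Lift.coe_pow, ← pow_mul, mul_comm q n, pow_mul,
    CircleDeg1Lift.coe_pow, (F ^ n).iterate_eq_of_map_eq_add_int hm]
  linarith

theorem exists_lift_pow_eq (hF : IsLift (S a b) F) (hq : 0 < q)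
    (hτ : F.translationNumber = p / q) : ∃ t, (F ^ q) t = t + p :=
  (F.translationNumber_eq_rat_iff hF.1 hq).mp hτ

/-- The fixed rays of `T` when one of the slopes is less than `2`. -/
theorem fixed_multiplier_mul_eq_one (hab : a < 2 ∨ b < 2) {u v : Circle} (huv : u ≠ v)
    (hl : 0 < l) (hm : 0 < m) (hlu : T a b (u : ℂ) = l • (u : ℂ))
    (hmv : T a b (v : ℂ) = m • (v : ℂ)) : l * m = 1 ∧ l ≠ 1 := by
  -- An invariant ray is spanned by `±(l, 1)`, and its slope is `l + 1 / l ≥ 2`.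
  have key : ∀ (w : Circle) (l : ℝ), 0 < l → T a b (w : ℂ) = l • (w : ℂ) →
      ((w : ℂ) = (w : ℂ).im • (⟨l, 1⟩ : ℂ)) ∧ (w : ℂ).im ≠ 0 ∧
      slope a b (w : ℂ).im * l = l ^ 2 + 1 := by
    intro w l hl h
    have him : (w : ℂ).re = l * (w : ℂ).im := by simpa using congrArg Complex.im h
    have hre : slope a b (w : ℂ).re * (w : ℂ).re - (w : ℂ).im = l * (w : ℂ).re := by
      simpa using congrArg Complex.re h
    have h0 : (w : ℂ).im ≠ 0 := fun h0 => w.coe_ne_zero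
      (by apply Complex.ext <;> simp [him, h0])
    refine ⟨?_, h0, ?_⟩
    · apply Complex.ext
      · simp [him, mul_comm]
      · simp
    · rw [him, slope_mul_pos hl] at hre
      apply mul_right_cancel₀ h0
      linarith
  obtain ⟨hu1, hu2, hu3⟩ := key u l hl hlu
  obtain ⟨hv1, hv2, hv3⟩ := key v m hm hmv
  have ha : ∀ {l c : ℝ}, 0 < l → c * l = l ^ 2 + 1 → 2 ≤ c := by
    intro l c hl h
    nlinarith [sq_nonneg (l - 1)]
  -- Only one half-plane can have slope at least `2`, so both rays lie in it, and `l`, `m` are roots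
  -- of the same `x ^ 2 - c * x + 1`.
  have hsign : 0 < (u : ℂ).im * (v : ℂ).im ∧
      slope a b (u : ℂ).im = slope a b (v : ℂ).im := by
    have h1 := ha hl hu3
    have h2 := ha hm hv3
    unfold slope at h1 h2 ⊢
    rcases lt_or_gt_of_ne hu2 with h | h <;> rcases lt_or_gt_of_ne hv2 with h' | h'
    · exact ⟨mul_pos_of_neg_of_neg h h', by simp [not_le.mpr h, not_le.mpr h']⟩
    · rw [if_neg (not_le.mpr h)] at h1
      rw [if_pos h'.le] at h2
      rcases hab with hab | hab <;> linarith
    · rw [if_pos h.le] at h1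
      rw [if_neg (not_le.mpr h')] at h2
      rcases hab with hab | hab <;> linarith
    · exact ⟨mul_pos h h', by simp [h.le, h'.le]⟩
  have hlm : l ≠ m := by
    rintro rfl
    apply huv
    have e : (⟨l, 1⟩ : ℂ) = (v : ℂ).im⁻¹ • (v : ℂ) := by
      rw [eq_inv_smul_iff₀ hv2, ← hv1]
    rw [e, smul_smul] at hu1
    have hpos : 0 < (u : ℂ).im * (v : ℂ).im⁻¹ := by
      rw [← div_eq_mul_inv, div_pos_iff]
      exact pos_and_pos_or_neg_and_neg_of_mul_pos hsign.1
    exact circle_eq_of_smul_eq one_pos hpos (by rw [one_smul]; exact hu1)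
  have hprod : l * m = 1 := by
    rw [← hsign.2] at hv3
    apply mul_left_cancel₀ (sub_ne_zero.mpr hlm)
    linear_combination l * hv3 - m * hu3
  refine ⟨hprod, ?_⟩
  rintro rfl
  exact hlm (by linarith)

end PlaneRec
end

/-! ### Growth and decay of norms along orbits. -/

noncomputable section

namespace PlaneRec

open Filter Topology

variable {a b : ℝ} {F : CircleDeg1Lift} {q : ℕ} {p : ℤ} {s t l m : ℝ}

/-- The lower bound is the upper bound for the inverse map, obtained by reflection. -/
theorem exists_lipschitz (a b : ℝ) : ∃ C : ℝ, 1 ≤ C ∧ ∀ (n : ℕ) (z : ℂ),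
    ‖(T a b)^[n] z‖ ≤ C ^ n * ‖z‖ ∧ ‖z‖ ≤ C ^ n * ‖(T a b)^[n] z‖ := by
  set C := |a| + |b| + 2 with hC
  have hC1 : 1 ≤ C := by linarith [abs_nonneg a, abs_nonneg b]
  have h1 : ∀ z, ‖T a b z‖ ≤ C * ‖z‖ := by
    intro z
    have hs : |slope a b z.re| ≤ |a| + |b| := by
      unfold slope
      split_ifs
      · linarith [abs_nonneg b]
      · linarith [abs_nonneg a]
    calc ‖T a b z‖ ≤ |(T a b z).re| + |(T a b z).im| := Complex.norm_le_abs_re_add_abs_im _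
      _ ≤ (|slope a b z.re| * |z.re| + |z.im|) + |z.re| := by
          rw [T_re, T_im, ← abs_mul]; gcongr; exact abs_sub _ _
      _ ≤ ((|a| + |b|) * ‖z‖ + ‖z‖) + ‖z‖ := by
          gcongr
          · exact Complex.abs_re_le_norm z
          · exact Complex.abs_im_le_norm z
          · exact Complex.abs_re_le_norm z
      _ = C * ‖z‖ := by rw [hC]; ring
  have h2 : ∀ z, ‖z‖ ≤ C * ‖T a b z‖ := by
    intro z
    have h := h1 (swap (T a b z))
    have e := T_swap_T_swap (a := a) (b := b) (swap z)
    rw [swap_swap] at e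
    rwa [e, norm_swap, norm_swap] at h
  refine ⟨C, hC1, fun n => ?_⟩
  induction n with
  | zero => intro z; simp
  | succ n ih =>
    intro z
    rw [Function.iterate_succ_apply', pow_succ']
    constructor
    · calc _ ≤ C * ‖(T a b)^[n] z‖ := h1 _
        _ ≤ C * (C ^ n * ‖z‖) := by gcongr; exact (ih z).1
        _ = _ := by ring
    · calc ‖z‖ ≤ C ^ n * ‖(T a b)^[n] z‖ := (ih z).2
        _ ≤ C ^ n * (C * ‖T a b ((T a b)^[n] z)‖) := by gcongr; exact h2 _
        _ = _ := by ring

theorem tendsto_norm_of_mul (hq : 0 < q) {z : ℂ}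
    (h : Tendsto (fun m => ‖(T a b)^[q * m] z‖) atTop atTop) :
    Tendsto (fun n => ‖(T a b)^[n] z‖) atTop atTop := by
  obtain ⟨C, hC1, hC⟩ := exists_lipschitz a b
  have hdiv := (h.comp (Nat.tendsto_div_const_atTop hq.ne')).const_mul_atTop
    (inv_pos.mpr (pow_pos (zero_lt_one.trans_le hC1) q))
  refine tendsto_atTop_mono (fun n => ?_) hdiv
  rw [inv_mul_le_iff₀ (by positivity), Function.comp_apply]
  have h1 := (hC (n % q) ((T a b)^[q * (n / q)] z)).2
  rw [← Function.iterate_add_apply, Nat.mod_add_div] at h1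
  exact h1.trans (by gcongr; exact (Nat.mod_lt n hq).le)

theorem tendsto_norm_zero_of_mul (hq : 0 < q) {z : ℂ}
    (h : Tendsto (fun m => ‖(T a b)^[q * m] z‖) atTop (𝓝 0)) :
    Tendsto (fun n => ‖(T a b)^[n] z‖) atTop (𝓝 0) := by
  obtain ⟨C, hC1, hC⟩ := exists_lipschitz a b
  have hdiv := (h.comp (Nat.tendsto_div_const_atTop hq.ne')).const_mul (C ^ q)
  rw [mul_zero] at hdiv
  refine squeeze_zero (fun n => norm_nonneg _) (fun n => ?_) hdiv
  have h1 := (hC (n % q) ((T a b)^[q * (n / q)] z)).1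
  rw [← Function.iterate_add_apply, Nat.mod_add_div] at h1
  exact h1.trans (by rw [Function.comp_apply]; gcongr; exact (Nat.mod_lt n hq).le)

theorem eventually_const_of_bounded {z : ℕ → ℤ} (hz : Monotone z ∨ Antitone z) {x y : ℤ}
    (hx : ∀ n, x ≤ z n) (hy : ∀ n, z n ≤ y) : ∃ M, ∀ n, M ≤ n → z n = z M := by
  rcases hz with hz | hz
  · obtain ⟨c, ⟨M, rfl⟩, hM⟩ := Int.exists_greatest_of_bdd (P := fun c => ∃ n, z n = c)
      ⟨y, by rintro _ ⟨n, rfl⟩; exact hy n⟩ ⟨_, 0, rfl⟩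
    exact ⟨M, fun n hn => le_antisymm (hM _ ⟨n, rfl⟩) (hz hn)⟩
  · obtain ⟨c, ⟨M, rfl⟩, hM⟩ := Int.exists_least_of_bdd (P := fun c => ∃ n, z n = c)
      ⟨x, by rintro _ ⟨n, rfl⟩; exact hx n⟩ ⟨_, 0, rfl⟩
    exact ⟨M, fun n hn => le_antisymm (hz hn) (hM _ ⟨n, rfl⟩)⟩

/-- Points whose direction is not periodic escape to infinity in forward time. -/
theorem tendsto_norm_of_not_periodic (hF : IsLift (S a b) F) (hq : 0 < q)
    (hfix : ∃ s, (F ^ q) s = s + p) (ht : (F ^ q) t ≠ t + p) :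
    Tendsto (fun n => ‖(T a b)^[n] (ray t : ℂ)‖) atTop atTop := by
  refine tendsto_norm_of_mul hq ?_
  obtain ⟨s, hs⟩ := hfix
  set f : ℝ → ℝ := fun x => (F ^ q) x - p with hf
  have hfmono : StrictMono f := fun x y h => sub_lt_sub_right (lift_pow_strictMono hF q h) _
  set g : ℕ → ℝ := fun n => f^[n] t with hg
  have hgs : ∀ n, g (n + 1) = f (g n) := fun n => Function.iterate_succ_apply' f n t
  have hg0 : g 0 = t := rfl
  have hft : f t ≠ t := fun h => ht (sub_eq_iff_eq_add.mp h)
  have hmono : Monotone g ∨ Antitone g := by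
    rcases lt_or_gt_of_ne hft with h | h
    · exact Or.inr (hfmono.strictAnti_iterate_of_map_lt h).antitone
    · exact Or.inl (hfmono.strictMono_iterate_of_lt_map h).monotone
  have hne : ∀ n, g n ≠ g (n + 1) := by
    intro n
    rcases lt_or_gt_of_ne hft with h | h
    · exact (hfmono.strictAnti_iterate_of_map_lt h n.lt_succ_self).ne'
    · exact (hfmono.strictMono_iterate_of_lt_map h n.lt_succ_self).ne
  have hfs : ∀ k : ℤ, f (s + k) = s + k := by
    intro k
    simp only [hf, CircleDeg1Lift.map_add_int, hs]; ring
  -- The translates of `s` are fixed by `f` and trap the monotone sequence `g`, so `g` converges and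
  -- the hit counts stabilise.
  set x := s + ⌊t - s⌋ with hx
  set y := s + ⌈t - s⌉ with hy
  have hxg : ∀ n, x ≤ g n := by
    intro n
    induction n with
    | zero => rw [hg0]; linarith [Int.floor_le (t - s)]
    | succ n ih => rw [hgs, hx, ← hfs]; exact hfmono.monotone ih
  have hgy : ∀ n, g n ≤ y := by
    intro n
    induction n with
    | zero => rw [hg0]; linarith [Int.le_ceil (t - s)]
    | succ n ih => rw [hgs, hy, ← hfs]; exact hfmono.monotone ih
  obtain ⟨c, hc⟩ : ∃ c, Tendsto g atTop (𝓝 c) := by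
    rcases hmono with h | h
    · exact ⟨_, tendsto_atTop_ciSup h ⟨y, by rintro _ ⟨n, rfl⟩; exact hgy n⟩⟩
    · exact ⟨_, tendsto_atTop_ciInf h ⟨x, by rintro _ ⟨n, rfl⟩; exact hxg n⟩⟩
  have hconst : ∀ c : ℝ, ∃ M, ∀ n, M ≤ n → hits F q c (g n) = hits F q c (g M) := fun c =>
    eventually_const_of_bounded (hmono.imp hits_mono.comp hits_mono.comp_antitone)
      (fun n => hits_mono (hxg n)) (fun n => hits_mono (hgy n))
  have hfloor : ∀ c : ℝ, ∃ M, ∀ n, M ≤ n → ∀ j < q,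
      ⌊(F ^ j) (g n) + c⌋ = ⌊(F ^ j) (g (n + 1)) + c⌋ := by
    intro c
    obtain ⟨M, hM⟩ := hconst c
    refine ⟨M, fun n hn j hj => ?_⟩
    have h1 : hits F q c (g n) = hits F q c (g (n + 1)) := by
      rw [hM n hn, hM (n + 1) (by omega)]
    rcases le_total (g n) (g (n + 1)) with h | h
    · exact floor_eq_of_hits_eq h h1 hj
    · exact (floor_eq_of_hits_eq h h1.symm hj).symm
  obtain ⟨M₁, hM₁⟩ := hfloor (1 / 4)
  obtain ⟨M₂, hM₂⟩ := hfloor (-1 / 4)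
  set M := max M₁ M₂ with hM
  set R : ℕ → ℝ := fun n => ‖(T a b)^[q * n] (ray t : ℂ)‖ with hR
  have hRpos : ∀ n, 0 < R n := fun n => norm_pos_iff.mpr (T_circle_ne_zero _ _)
  have hpow : ∀ n : ℕ, (F ^ (q * n)) t = g n + (n * p : ℤ) := by
    intro n
    induction n with
    | zero => simp [hg0]
    | succ n ih =>
      rw [Nat.mul_succ, add_comm, pow_add, CircleDeg1Lift.mul_apply, ih,
        CircleDeg1Lift.map_add_int, hgs, hf]
      push_cast; ring
  have hdir : ∀ n, (T a b)^[q * n] (ray t : ℂ) = R n • (ray (g n) : ℂ) := by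
    intro n
    rw [T_iterate_circle, S_iterate_ray hF, hpow, ray_add_int]
  -- Once the counts are constant, consecutive vectors always share a half-plane, so their area `W`
  -- stays constant.
  set W : ℕ → ℝ := fun n =>
    cross ((T a b)^[q * n] (ray t : ℂ)) ((T a b)^[q * (n + 1)] (ray t : ℂ)) with hW
  have hWeq : ∀ n, W n = R n * R (n + 1) * cross (ray (g n)) (ray (g (n + 1))) := by
    intro n
    simp only [hW]
    rw [hdir, hdir, cross_smul_smul]
  have hWs : ∀ n, M ≤ n → W (n + 1) = W n := by
    intro n hn
    have h1 : W (n + 1) = cross ((T a b)^[q] ((T a b)^[q * n] (ray t : ℂ)))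
        ((T a b)^[q] ((T a b)^[q * (n + 1)] (ray t : ℂ))) := by
      simp only [hW]
      rw [← Function.iterate_add_apply, ← Function.iterate_add_apply, add_comm q, add_comm q,
        ← Nat.mul_succ, ← Nat.mul_succ]
    rw [h1, cross_T_iterate, Finset.sum_eq_zero, add_zero]
    intro j hj
    have hj := Finset.mem_range.mp hj
    apply jump_eq_zero
    rw [hdir, hdir, T_iterate_smul (hRpos _), T_iterate_smul (hRpos _), Complex.smul_re,
      Complex.smul_re, smul_eq_mul, smul_eq_mul, mul_mul_mul_comm]
    exact mul_nonneg (mul_pos (hRpos _) (hRpos _)).le (re_mul_re_nonneg hF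
      (hM₁ n (le_trans (le_max_left _ _) hn) j hj) (hM₂ n (le_trans (le_max_right _ _) hn) j hj))
  have hWconst : ∀ n, M ≤ n → W n = W M := by
    intro n hn
    induction n, hn using Nat.le_induction with
    | base => rfl
    | succ n hn ih => rw [hWs n hn, ih]
  have hWne : W M ≠ 0 := by
    rw [hWeq]
    refine mul_ne_zero (mul_pos (hRpos _) (hRpos _)).ne' ?_
    have e1 := hM₁ M (le_max_left _ _) 0 hq
    have e2 := hM₂ M (le_max_right _ _) 0 hq
    rcases lt_or_gt_of_ne (hne M) with h | h
    · exact (cross_ray_pos h (sub_lt_half e1 e2)).ne'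
    · have h1 := cross_ray_pos h (sub_lt_half e1.symm e2.symm)
      intro h0
      simp only [cross] at h0 h1
      linarith
  obtain ⟨C, hC1, hC⟩ := exists_lipschitz a b
  have hRC : ∀ n, R (n + 1) ≤ C ^ q * R n := by
    intro n
    have := (hC q ((T a b)^[q * n] (ray t : ℂ))).1
    rw [← Function.iterate_add_apply, add_comm, ← Nat.mul_succ] at this
    exact this
  have hcross : Tendsto (fun n => |cross (ray (g n)) (ray (g (n + 1)))|) atTop (𝓝 0) := by
    have h1 := ((hc.comp (tendsto_add_atTop_nat 1)).sub hc).const_mul (2 * Real.pi)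
    have h2 := (Real.continuous_sin.abs.tendsto _).comp h1
    simp only [sub_self, mul_zero, Real.sin_zero, abs_zero] at h2
    exact h2.congr fun n => by rw [cross_ray]; rfl
  rw [tendsto_atTop]
  intro K
  have hK : 0 < max K 1 := lt_max_of_lt_right one_pos
  have hCq : 0 < C ^ q := pow_pos (by linarith) q
  have hev := hcross.eventually (gt_mem_nhds
    (show 0 < |W M| / (C ^ q * max K 1 ^ 2) from div_pos (abs_pos.mpr hWne) (by positivity)))
  filter_upwards [hev, eventually_ge_atTop M] with n hn hMn
  by_contra! hlt
  have hlt' : R n < max K 1 := lt_max_of_lt_left hlt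
  rw [lt_div_iff₀ (by positivity)] at hn
  -- A bounded `R n` would bound `R n * R (n + 1)`, and the vanishing sine of the angle would push
  -- the area below `|W M|`.
  have h1 : |W M| ≤ |cross (ray (g n)) (ray (g (n + 1)))| * (C ^ q * max K 1 ^ 2) := by
    rw [← hWconst n hMn, hWeq, abs_mul, abs_of_pos (mul_pos (hRpos _) (hRpos _)), mul_comm]
    refine mul_le_mul_of_nonneg_left ?_ (abs_nonneg _)
    calc R n * R (n + 1) ≤ R n * (C ^ q * R n) := mul_le_mul_of_nonneg_left (hRC n) (hRpos n).le
      _ = C ^ q * R n ^ 2 := by ring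
      _ ≤ C ^ q * max K 1 ^ 2 := mul_le_mul_of_nonneg_left
          (pow_le_pow_left₀ (hRpos n).le hlt'.le 2) hCq.le
  linarith

theorem tendsto_norm_zpow_atTop {L : Filter ℝ} {w : ℂ}
    (h : Tendsto (fun n : ℕ => ‖(T a b)^[n] w‖) atTop L) :
    Tendsto (fun n : ℤ => ‖(T a b ^ n) w‖) atTop L := by
  have hn : Tendsto Int.toNat atTop atTop :=
    tendsto_atTop.mpr fun k => (eventually_ge_atTop (k : ℤ)).mono fun n hn => by omega
  refine (h.comp hn).congr' ?_
  filter_upwards [eventually_ge_atTop 0] with n hn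
  lift n to ℕ using hn
  simp [Equiv.Perm.iterate_eq_pow]

theorem tendsto_norm_zpow_atBot {L : Filter ℝ} {w : ℂ}
    (h : Tendsto (fun n : ℕ => ‖(T a b)^[n] (swap w)‖) atTop L) :
    Tendsto (fun n : ℤ => ‖(T a b ^ n) w‖) atBot L := by
  refine ((tendsto_norm_zpow_atTop h).comp tendsto_neg_atBot_atTop).congr' ?_
  filter_upwards [eventually_le_atBot 0] with n hn
  obtain ⟨k, rfl⟩ := Int.exists_eq_neg_ofNat hn
  rw [Function.comp_apply, neg_neg, zpow_neg, zpow_natCast, ← inv_pow,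
    T_inv_pow_apply, norm_swap, Equiv.Perm.iterate_eq_pow]

theorem exists_circle_smul {w : ℂ} (hw : w ≠ 0) : ∃ (u : Circle) (c : ℝ), 0 < c ∧ w = c • (u : ℂ) := by
  have h : (‖w‖ : ℂ) ≠ 0 := by exact_mod_cast norm_ne_zero_iff.mpr hw
  refine ⟨⟨w / ‖w‖, mem_sphere_zero_iff_norm.mpr (by simp [hw])⟩, ‖w‖, norm_pos_iff.mpr hw, ?_⟩
  rw [Complex.real_smul]
  exact (mul_div_cancel₀ w h).symm

theorem multiplier_swap {w : ℂ} (hl : 0 < l) (h : (T a b)^[q] w = l • w) :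
    (T a b)^[q] (swap w) = l⁻¹ • swap w := by
  have h1 := T_iterate_swap h
  rw [swap_smul, T_iterate_smul hl] at h1
  rw [eq_inv_smul_iff₀ hl.ne', h1]

theorem multiplier_of_smul {c : ℝ} (hc : 0 < c) {w : ℂ} :
    (T a b)^[q] (c • w) = l • c • w ↔ (T a b)^[q] w = l • w := by
  rw [T_iterate_smul hc, smul_comm]
  exact (smul_right_injective ℂ hc.ne').eq_iff

theorem tendsto_norm_of_one_lt {w : ℂ} (hw : w ≠ 0) (hq : 0 < q) (hl : 1 < l)
    (h : (T a b)^[q] w = l • w) : Tendsto (fun n => ‖(T a b)^[n] w‖) atTop atTop := by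
  refine tendsto_norm_of_mul hq ?_
  have h0 : 0 < l := by linarith
  refine ((tendsto_pow_atTop_atTop_of_one_lt hl).atTop_mul_const (norm_pos_iff.mpr hw)).congr ?_
  intro n
  rw [T_iterate_mul_smul_eq h0 h, norm_smul, Real.norm_of_nonneg (pow_pos h0 n).le]

theorem tendsto_norm_of_lt_one {w : ℂ} (hq : 0 < q) (hl0 : 0 < l) (hl : l < 1)
    (h : (T a b)^[q] w = l • w) : Tendsto (fun n => ‖(T a b)^[n] w‖) atTop (𝓝 0) := by
  refine tendsto_norm_zero_of_mul hq ?_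
  have h1 := (tendsto_pow_atTop_nhds_zero_of_lt_one hl0.le hl).mul_const ‖w‖
  rw [zero_mul] at h1
  refine h1.congr fun n => ?_
  rw [T_iterate_mul_smul_eq hl0 h, norm_smul, Real.norm_of_nonneg (pow_pos hl0 n).le]

theorem tendsto_of_one_lt {w : ℂ} (hw : w ≠ 0) (hq : 0 < q) (hl : 1 < l)
    (h : (T a b)^[q] w = l • w) :
    Tendsto (fun n : ℤ => ‖(T a b ^ n) w‖) atTop atTop ∧
      Tendsto (fun n : ℤ => ‖(T a b ^ n) w‖) atBot (𝓝 0) :=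
  ⟨tendsto_norm_zpow_atTop (tendsto_norm_of_one_lt hw hq hl h), tendsto_norm_zpow_atBot
    (tendsto_norm_of_lt_one hq (inv_pos.mpr (by linarith)) (inv_lt_one_of_one_lt₀ hl)
      (multiplier_swap (by linarith) h))⟩

theorem tendsto_of_lt_one {w : ℂ} (hw : w ≠ 0) (hq : 0 < q) (hl0 : 0 < l) (hl : l < 1)
    (h : (T a b)^[q] w = l • w) :
    Tendsto (fun n : ℤ => ‖(T a b ^ n) w‖) atTop (𝓝 0) ∧
      Tendsto (fun n : ℤ => ‖(T a b ^ n) w‖) atBot atTop :=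
  ⟨tendsto_norm_zpow_atTop (tendsto_norm_of_lt_one hq hl0 hl h), tendsto_norm_zpow_atBot
    (tendsto_norm_of_one_lt (swap_ne_zero hw) hq ((one_lt_inv₀ hl0).mpr hl)
      (multiplier_swap hl0 h))⟩

end PlaneRec
end

/-! ### Asymptotics when the circle map has one or two periodic orbits. -/

noncomputable section

namespace PlaneRec

open Filter Topology

variable {a b : ℝ} {F : CircleDeg1Lift} {q : ℕ} {p : ℤ} {l m : ℝ} {u v : Circle}

theorem S_iterate_of_periodic (hF : IsLift (S a b) F) (hq : 0 < q)
    (hτ : F.translationNumber = p / q) (hu : u ∈ Function.periodicPts (S a b)) :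
    (S a b)^[q] u = u := by
  obtain ⟨t, rfl⟩ := ray_surjective u
  rw [S_iterate_ray hF, lift_pow_eq_of_periodic hF hq hτ hu rfl, ray_add_int]

theorem exists_multiplier (hu : (S a b)^[q] u = u) :
    ∃ l : ℝ, 0 < l ∧ (T a b)^[q] (u : ℂ) = l • (u : ℂ) :=
  ⟨_, norm_pos_iff.mpr (T_circle_ne_zero q u), by rw [T_iterate_circle q u, norm_smul, norm_norm,
    Circle.norm_coe, mul_one, hu]⟩

theorem mem_periodicPts_of_multiplier (hq : 0 < q) (hl : 0 < l)
    (h : (T a b)^[q] (u : ℂ) = l • (u : ℂ)) : u ∈ Function.periodicPts (S a b) :=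
  ⟨q, hq, S_iterate_eq_of_smul hl h⟩

theorem tendsto_of_forall_ne (hF : IsLift (S a b) F) (hq : 0 < q)
    (hτ : F.translationNumber = p / q) {w : ℂ} (hw : w ≠ 0)
    (hne : ∀ l : ℝ, 0 < l → (T a b)^[q] w ≠ l • w) :
    Tendsto (fun n : ℤ => ‖(T a b ^ n) w‖) atTop atTop ∧
      Tendsto (fun n : ℤ => ‖(T a b ^ n) w‖) atBot atTop := by
  have forward : ∀ w : ℂ, w ≠ 0 → (∀ l : ℝ, 0 < l → (T a b)^[q] w ≠ l • w) →
      Tendsto (fun n : ℕ => ‖(T a b)^[n] w‖) atTop atTop := by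
    intro w hw hne
    obtain ⟨u, c, hc, rfl⟩ := exists_circle_smul hw
    obtain ⟨t, rfl⟩ := ray_surjective u
    have h := tendsto_norm_of_not_periodic hF hq (exists_lift_pow_eq hF hq hτ) (t := t) (by
      intro h
      obtain ⟨l, hl, h⟩ := exists_multiplier (a := a) (b := b) (q := q) (u := ray t)
        (by rw [S_iterate_ray hF, h, ray_add_int])
      exact hne l hl ((multiplier_of_smul hc).mpr h))
    refine (h.const_mul_atTop hc).congr fun n => ?_
    rw [T_iterate_smul hc, norm_smul, Real.norm_of_nonneg hc.le]
  refine ⟨tendsto_norm_zpow_atTop (forward w hw hne), tendsto_norm_zpow_atBot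
    (forward _ (swap_ne_zero hw) fun l hl h => ?_)⟩
  exact hne l⁻¹ (inv_pos.mpr hl) (multiplier_swap hl h)

/-- Orbits are forward ranges, so returning from `v` to `u` takes `n * (q - 1)` further steps,
completing `n` periods. -/
theorem orbit_eq_of_iterate_eq (hq : 0 < q) (hu : (S a b)^[q] u = u) {n : ℕ}
    (h : (S a b)^[n] u = v) :
    (Set.range fun k : ℕ => (S a b)^[k] v) = Set.range fun k : ℕ => (S a b)^[k] u := by
  subst h
  apply Set.Subset.antisymm
  · rintro _ ⟨k, rfl⟩
    exact ⟨k + n, Function.iterate_add_apply _ k n u⟩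
  · rintro _ ⟨k, rfl⟩
    refine ⟨k + n * (q - 1), ?_⟩
    have hper : Function.IsPeriodicPt (S a b) (q * n) u := Function.IsPeriodicPt.mul_const hu n
    have e : k + n * (q - 1) + n = k + q * n := by
      obtain ⟨r, rfl⟩ := Nat.exists_eq_succ_of_ne_zero hq.ne'
      simp only [Nat.succ_eq_add_one, Nat.add_sub_cancel]; ring
    change (S a b)^[k + n * (q - 1)] ((S a b)^[n] u) = (S a b)^[k] u
    rw [← Function.iterate_add_apply, e, Function.iterate_add_apply, hper.eq]

theorem multiplier_eq_of_mem_orbit (hl : 0 < l) (hu : (T a b)^[q] (u : ℂ) = l • (u : ℂ))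
    (hv : v ∈ Set.range fun k : ℕ => (S a b)^[k] u) : (T a b)^[q] (v : ℂ) = l • (v : ℂ) := by
  obtain ⟨k, rfl⟩ := hv
  exact T_iterate_S_iterate hl hu k

theorem multiplier_unique {w : ℂ} (hw : w ≠ 0) (h1 : (T a b)^[q] w = l • w)
    (h2 : (T a b)^[q] w = m • w) : l = m :=
  smul_left_injective ℝ hw (h1.symm.trans h2)

theorem orbit_finite (hq : 0 < q) (hu : (S a b)^[q] u = u) :
    (Set.range fun k : ℕ => (S a b)^[k] u).Finite := by
  refine ((Set.finite_Iio q).image fun k => (S a b)^[k] u).subset ?_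
  rintro _ ⟨k, rfl⟩
  have hper : Function.IsPeriodicPt (S a b) q u := hu
  exact ⟨k % q, Nat.mod_lt k hq, hper.iterate_mod_apply k⟩

/-- If the circle map has one periodic orbit then so does the plane map, up to scaling, and all
other points escape to infinity. -/
theorem one_orbit (hF : IsLift (S a b) F) (hq : 0 < q) (hτ : F.translationNumber = p / q)
    (hu : u ∈ Function.periodicPts (S a b))
    (hone : ∀ v ∈ Function.periodicPts (S a b), v ∈ Set.range fun k : ℕ => (S a b)^[k] u) :
    ∃ O ∈ periodicOrbits (T a b), O ≠ {0} ∧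
      (∀ O' ∈ periodicOrbits (T a b), O' ≠ {0} →
        ∃ c : ℝ, 0 < c ∧ O' = (fun z : ℂ => c • z) '' O) ∧
      ∀ w : ℂ, w ≠ 0 → (∀ c : ℝ, 0 < c → w ∉ (fun z : ℂ => c • z) '' O) →
        Tendsto (fun n : ℤ => ‖(T a b ^ n) w‖) atTop atTop ∧
        Tendsto (fun n : ℤ => ‖(T a b ^ n) w‖) atBot atTop := by
  have hSu := S_iterate_of_periodic hF hq hτ hu
  obtain ⟨l, hl, hlu⟩ := exists_multiplier (a := a) (b := b) hSu
  -- The reflected ray is periodic with multiplier `l⁻¹` and must lie on the only orbit.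
  have hl1 : l = 1 := by
    obtain ⟨v, c, hc, hv⟩ := exists_circle_smul (swap_ne_zero u.coe_ne_zero)
    have h1 := multiplier_swap hl hlu
    rw [hv, multiplier_of_smul hc] at h1
    have h2 := multiplier_eq_of_mem_orbit hl hlu
      (hone v (mem_periodicPts_of_multiplier hq (inv_pos.mpr hl) h1))
    have h3 := multiplier_unique v.coe_ne_zero h1 h2
    have h4 : l * l = 1 := by
      nth_rewrite 1 [← h3]
      exact inv_mul_cancel₀ hl.ne'
    nlinarith
  subst hl1
  have hray : ∀ w : ℂ, w ≠ 0 → ∀ l : ℝ, 0 < l → (T a b)^[q] w = l • w →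
      ∃ c : ℝ, 0 < c ∧ ∃ k : ℕ, w = c • (T a b)^[k] (u : ℂ) := by
    intro w hw l hl h
    obtain ⟨v, c, hc, rfl⟩ := exists_circle_smul hw
    obtain ⟨k, hk⟩ := hone v
      (mem_periodicPts_of_multiplier hq hl ((multiplier_of_smul hc).mp h))
    have hpos : 0 < ‖(T a b)^[k] (u : ℂ)‖ := norm_pos_iff.mpr (T_circle_ne_zero k u)
    refine ⟨c * ‖(T a b)^[k] (u : ℂ)‖⁻¹, mul_pos hc (inv_pos.mpr hpos), k, ?_⟩
    rw [mul_smul]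
    congr 1
    rw [eq_inv_smul_iff₀ hpos.ne', T_iterate_circle k u]
    simp only [norm_smul, norm_norm, Circle.norm_coe, mul_one]
    rw [← hk]
  have hTu : Function.IsPeriodicPt (T a b) q (u : ℂ) := by
    rw [one_smul] at hlu; exact hlu
  refine ⟨Set.range fun n : ℕ => (T a b)^[n] (u : ℂ), ⟨u, ⟨q, hq, hTu⟩, rfl⟩, ?_, ?_, ?_⟩
  · intro h
    have : (u : ℂ) ∈ ({0} : Set ℂ) := h ▸ ⟨0, rfl⟩
    exact u.coe_ne_zero this
  · rintro _ ⟨w, ⟨n, hn, hnw⟩, rfl⟩ hne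
    have hw : w ≠ 0 := by
      rintro rfl
      apply hne
      simp only [T_iterate_zero, Set.range_const]
    obtain ⟨v, d, hd, hv⟩ := exists_circle_smul hw
    have hSv : v ∈ Function.periodicPts (S a b) := by
      refine ⟨n, hn, S_iterate_eq_of_smul one_pos ?_⟩
      have h1 : (T a b)^[n] w = (1 : ℝ) • w := by rw [one_smul]; exact hnw
      rw [hv] at h1
      exact (multiplier_of_smul hd).mp h1
    obtain ⟨r, hr, hrv⟩ := exists_multiplier (a := a) (b := b) (S_iterate_of_periodic hF hq hτ hSv)
    obtain ⟨c, hc, k, hk⟩ := hray w hw r hr (by rw [hv]; exact (multiplier_of_smul hd).mpr hrv)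
    refine ⟨c, hc, ?_⟩
    rw [hk]
    apply Set.Subset.antisymm
    · rintro _ ⟨j, rfl⟩
      exact ⟨_, ⟨j + k, rfl⟩, by
        simp only [T_iterate_smul hc]; rw [Function.iterate_add_apply]⟩
    · rintro _ ⟨_, ⟨j, rfl⟩, rfl⟩
      refine ⟨j + k * (q - 1), ?_⟩
      have e : j + k * (q - 1) + k = j + q * k := by
        obtain ⟨r, rfl⟩ := Nat.exists_eq_succ_of_ne_zero hq.ne'
        simp only [Nat.succ_eq_add_one, Nat.add_sub_cancel]; ring
      simp only [T_iterate_smul hc]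
      rw [← Function.iterate_add_apply, e, Function.iterate_add_apply, (hTu.mul_const k).eq]
  · intro w hw hwO
    refine tendsto_of_forall_ne hF hq hτ hw fun l hl h => ?_
    obtain ⟨c, hc, k, hk⟩ := hray w hw l hl h
    exact hwO c hc ⟨_, ⟨k, rfl⟩, hk.symm⟩

/-- If the circle map has two periodic orbits with multipliers `l` and `m`, one expanding and the
other contracting, these determine the asymptotics of all orbits of the plane map. -/
theorem two_orbits (hF : IsLift (S a b) F) (hq : 0 < q) (hτ : F.translationNumber = p / q)
    (hl : 1 < l) (hm0 : 0 < m) (hm : m < 1) (hlu : (T a b)^[q] (u : ℂ) = l • (u : ℂ))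
    (hmv : (T a b)^[q] (v : ℂ) = m • (v : ℂ)) {P Q : Set Circle}
    (hP : P = Set.range fun k : ℕ => (S a b)^[k] u) (hQ : Q = Set.range fun k : ℕ => (S a b)^[k] v)
    (htwo : ∀ x ∈ Function.periodicPts (S a b), x ∈ P ∨ x ∈ Q) :
    (∀ w : ℂ, w ≠ 0 → w ∉ Function.periodicPts (T a b)) ∧
    (∀ w ∈ rayPoints P, Tendsto (fun n : ℤ => ‖(T a b ^ n) w‖) atTop atTop ∧
      Tendsto (fun n : ℤ => ‖(T a b ^ n) w‖) atBot (𝓝 0)) ∧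
    (∀ w ∈ rayPoints Q, Tendsto (fun n : ℤ => ‖(T a b ^ n) w‖) atTop (𝓝 0) ∧
      Tendsto (fun n : ℤ => ‖(T a b ^ n) w‖) atBot atTop) ∧
    ∀ w : ℂ, w ≠ 0 → w ∉ rayPoints P → w ∉ rayPoints Q →
      Tendsto (fun n : ℤ => ‖(T a b ^ n) w‖) atTop atTop ∧
      Tendsto (fun n : ℤ => ‖(T a b ^ n) w‖) atBot atTop := by
  have hl0 : 0 < l := by linarith
  have hPl : ∀ x ∈ P, (T a b)^[q] (x : ℂ) = l • (x : ℂ) := fun x hx =>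
    multiplier_eq_of_mem_orbit hl0 hlu (hP ▸ hx)
  have hQm : ∀ x ∈ Q, (T a b)^[q] (x : ℂ) = m • (x : ℂ) := fun x hx =>
    multiplier_eq_of_mem_orbit hm0 hmv (hQ ▸ hx)
  refine ⟨?_, ?_, ?_, ?_⟩
  · rintro w hw ⟨n, hn, hnw⟩
    obtain ⟨x, c, hc, rfl⟩ := exists_circle_smul hw
    have h1 : (T a b)^[n] (x : ℂ) = (1 : ℝ) • (x : ℂ) := by
      rw [← multiplier_of_smul hc, one_smul]; exact hnw
    have hx : x ∈ Function.periodicPts (S a b) := mem_periodicPts_of_multiplier hn one_pos h1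
    -- Evaluating `T^(q * n)` in two ways shows that the multiplier of a periodic point is a root of
    -- unity.
    have h2 : ∀ r : ℝ, 0 < r → (T a b)^[q] (x : ℂ) = r • (x : ℂ) → r ^ n = 1 := by
      intro r hr h
      have h3 := T_iterate_mul_smul_eq hr h n
      have h4 := T_iterate_mul_smul_eq one_pos h1 q
      rw [one_pow, mul_comm] at h4
      exact multiplier_unique x.coe_ne_zero h3 h4
    rcases htwo x hx with h | h
    · exact absurd (h2 l hl0 (hPl x h)) (one_lt_pow₀ hl hn.ne').ne'
    · exact absurd (h2 m hm0 (hQm x h)) (pow_lt_one₀ hm0.le hm hn.ne').ne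
  · rintro w ⟨x, hx, c, hc, rfl⟩
    exact tendsto_of_one_lt (smul_ne_zero hc.ne' x.coe_ne_zero) hq hl
      ((multiplier_of_smul hc).mpr (hPl x hx))
  · rintro w ⟨x, hx, c, hc, rfl⟩
    exact tendsto_of_lt_one (smul_ne_zero hc.ne' x.coe_ne_zero) hq hm0 hm
      ((multiplier_of_smul hc).mpr (hQm x hx))
  · intro w hw hwP hwQ
    refine tendsto_of_forall_ne hF hq hτ hw fun r hr h => ?_
    obtain ⟨x, c, hc, rfl⟩ := exists_circle_smul hw
    rcases htwo x (mem_periodicPts_of_multiplier hq hr ((multiplier_of_smul hc).mp h)) with h | h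
    · exact hwP ⟨x, h, c, hc, rfl⟩
    · exact hwQ ⟨x, h, c, hc, rfl⟩

end PlaneRec

end

theorem theorem2p4 (a b : ℝ) (hab : a < 2 ∨ b < 2)
    (hrat : ∃ r : ℚ, PlaneRec.HasRotationNumber (PlaneRec.S a b) (r : ℝ)) :
    (PlaneRec.periodicOrbits (PlaneRec.S a b)).Nonempty ∧
    -- exactly one periodic orbit of the circle map
    (((PlaneRec.periodicOrbits (PlaneRec.S a b)).encard = 1 ∧
        ∃ O ∈ PlaneRec.periodicOrbits (PlaneRec.T a b), O ≠ {0} ∧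
          (∀ O' ∈ PlaneRec.periodicOrbits (PlaneRec.T a b), O' ≠ {0} →
            ∃ c : ℝ, 0 < c ∧ O' = (fun z : ℂ => c • z) '' O) ∧
          ∀ w : ℂ, w ≠ 0 → (∀ c : ℝ, 0 < c → w ∉ (fun z : ℂ => c • z) '' O) →
            Filter.Tendsto (fun n : ℤ => ‖(PlaneRec.T a b ^ n) w‖) Filter.atTop Filter.atTop ∧
            Filter.Tendsto (fun n : ℤ => ‖(PlaneRec.T a b ^ n) w‖) Filter.atBot Filter.atTop) ∨
    -- exactly two periodic orbits of the circle map
      (∃ P Q : Set Circle, P ≠ Q ∧ PlaneRec.periodicOrbits (PlaneRec.S a b) = {P, Q} ∧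
        (∀ w : ℂ, w ≠ 0 → w ∉ Function.periodicPts (PlaneRec.T a b)) ∧
        (∀ w ∈ PlaneRec.rayPoints P,
          Filter.Tendsto (fun n : ℤ => ‖(PlaneRec.T a b ^ n) w‖) Filter.atTop Filter.atTop ∧
          Filter.Tendsto (fun n : ℤ => ‖(PlaneRec.T a b ^ n) w‖) Filter.atBot (nhds 0)) ∧
        (∀ w ∈ PlaneRec.rayPoints Q,
          Filter.Tendsto (fun n : ℤ => ‖(PlaneRec.T a b ^ n) w‖) Filter.atTop (nhds 0) ∧
          Filter.Tendsto (fun n : ℤ => ‖(PlaneRec.T a b ^ n) w‖) Filter.atBot Filter.atTop) ∧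
        ∀ w : ℂ, w ≠ 0 → w ∉ PlaneRec.rayPoints P → w ∉ PlaneRec.rayPoints Q →
          Filter.Tendsto (fun n : ℤ => ‖(PlaneRec.T a b ^ n) w‖) Filter.atTop Filter.atTop ∧
          Filter.Tendsto (fun n : ℤ => ‖(PlaneRec.T a b ^ n) w‖) Filter.atBot Filter.atTop) ∨
    -- at least three periodic orbits of the circle map
      (3 ≤ (PlaneRec.periodicOrbits (PlaneRec.S a b)).encard ∧
        (∃ k : ℕ, 1 ≤ k ∧ PlaneRec.T a b ^ k = 1) ∧
        ∀ w : ℂ, w ∈ Function.periodicPts (PlaneRec.T a b))) := by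
  open PlaneRec in
  obtain ⟨r, F, hF, hr⟩ := hrat
  have hq : 0 < r.den := r.den_pos
  have hτ : F.translationNumber = r.num / r.den := by rw [hr]; exact Rat.cast_def r
  have hpq : IsCoprime r.num r.den := Int.isCoprime_iff_gcd_eq_one.mpr r.reduced
  generalize r.den = q at hq hτ hpq
  generalize r.num = p at hτ hpq
  have hmem : ∀ u ∈ Function.periodicPts (S a b),
      (Set.range fun k : ℕ => (S a b)^[k] u) ∈ periodicOrbits (S a b) := fun u hu => ⟨u, hu, rfl⟩
  have hSq : ∀ {u}, u ∈ Function.periodicPts (S a b) → (S a b)^[q] u = u := fun hu =>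
    S_iterate_of_periodic hF hq hτ hu
  have hpair : ∀ {u v : Circle} {l m : ℝ}, u ∈ Function.periodicPts (S a b) →
      (Set.range fun k : ℕ => (S a b)^[k] v) ≠ (Set.range fun k : ℕ => (S a b)^[k] u) →
      0 < l → 0 < m → (T a b)^[q] (u : ℂ) = l • (u : ℂ) → (T a b)^[q] (v : ℂ) = m • (v : ℂ) →
      l * m = 1 ∧ (l = 1 → ∀ z, (T a b)^[q] z = z) := by
    intro u v l m hu huv hl hm hlu hmv
    have hne : ∀ n, (S a b)^[n] u ≠ v := fun n hn => huv (orbit_eq_of_iterate_eq hq (hSq hu) hn)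
    -- For `q = 1` there is no second time to compare, and the bound on the slopes takes over; there
    -- `l = 1` is excluded.
    obtain rfl | hq2 : q = 1 ∨ 2 ≤ q := by omega
    · have h := fixed_multiplier_mul_eq_one hab (hne 0) hl hm hlu hmv
      exact ⟨h.1, fun h1 => absurd h1 h.2⟩
    · have h := multiplier_mul_eq_one hF hq2 hpq
        (fun t ht => lift_pow_eq_of_periodic hF hq hτ hu ht) hne hl hm hlu hmv
      refine ⟨h.1, fun h1 => h.2 h1 ?_⟩
      rw [← h.1, h1, one_mul]
  obtain ⟨t, ht⟩ := exists_lift_pow_eq hF hq hτ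
  have hu : ray t ∈ Function.periodicPts (S a b) := by
    refine ⟨q, hq, ?_⟩
    change (S a b)^[q] (ray t) = ray t
    rw [S_iterate_ray hF, ht, ray_add_int]
  generalize ray t = u at hu
  refine ⟨⟨_, hmem u hu⟩, ?_⟩
  have hself : ∀ v : Circle, v ∈ Set.range fun k : ℕ => (S a b)^[k] v := fun v => ⟨0, rfl⟩
  obtain ⟨l, hl, hlu⟩ := exists_multiplier (a := a) (b := b) (hSq hu)
  by_cases h2 : ∃ v ∈ Function.periodicPts (S a b),
      (Set.range fun k : ℕ => (S a b)^[k] v) ≠ (Set.range fun k : ℕ => (S a b)^[k] u)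
  swap
  · left
    push Not at h2
    have hsing : periodicOrbits (S a b) = {Set.range fun k : ℕ => (S a b)^[k] u} := by
      apply Set.Subset.antisymm
      · rintro _ ⟨v, hv, rfl⟩
        exact h2 v hv
      · rintro _ rfl
        exact hmem u hu
    exact ⟨by rw [hsing, Set.encard_singleton],
      one_orbit hF hq hτ hu fun v hv => h2 v hv ▸ hself v⟩
  obtain ⟨v, hv, hvu⟩ := h2
  obtain ⟨m, hm, hmv⟩ := exists_multiplier (a := a) (b := b) (hSq hv)
  obtain ⟨hlm, hid⟩ := hpair hu hvu hl hm hlu hmv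
  right
  by_cases h3 : ∃ x ∈ Function.periodicPts (S a b),
      (Set.range fun k : ℕ => (S a b)^[k] x) ≠ (Set.range fun k : ℕ => (S a b)^[k] u) ∧
      (Set.range fun k : ℕ => (S a b)^[k] x) ≠ (Set.range fun k : ℕ => (S a b)^[k] v)
  · right
    obtain ⟨x, hx, hxu, hxv⟩ := h3
    obtain ⟨n, hn, hnx⟩ := exists_multiplier (a := a) (b := b) (hSq hx)
    have h1 := (hpair hu hxu hl hn hlu hnx).1
    have h2 := (hpair hv hxv hm hn hmv hnx).1
    -- From `l * n = m * n = 1` and `l * m = 1`, positivity leaves only `l = 1`.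
    have hlm' : l = m := mul_right_cancel₀ hn.ne' (h1.trans h2.symm)
    have hTq := hid (by subst hlm'; nlinarith)
    refine ⟨?_, ⟨q, hq, ?_⟩, fun w => ⟨q, hq, hTq w⟩⟩
    · refine le_trans (le_of_eq ?_) (Set.encard_le_encard
        (s := {Set.range fun k : ℕ => (S a b)^[k] u, Set.range fun k : ℕ => (S a b)^[k] v,
          Set.range fun k : ℕ => (S a b)^[k] x}) ?_)
      · exact (Set.encard_eq_three.mpr ⟨_, _, _, hvu.symm, hxu.symm, hxv.symm, rfl⟩).symm
      · rintro _ (rfl | rfl | rfl)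
        exacts [hmem u hu, hmem v hv, hmem x hx]
    · ext1 w
      rw [← Equiv.Perm.iterate_eq_pow, hTq]; rfl
  · left
    push Not at h3
    have htwo : ∀ x ∈ Function.periodicPts (S a b),
        (x ∈ Set.range fun k : ℕ => (S a b)^[k] u) ∨ x ∈ Set.range fun k : ℕ => (S a b)^[k] v := by
      intro x hx
      by_cases h : (Set.range fun k : ℕ => (S a b)^[k] x) = Set.range fun k : ℕ => (S a b)^[k] u
      · exact Or.inl (h ▸ hself x)
      · exact Or.inr (h3 x hx h ▸ hself x)
    have horb : periodicOrbits (S a b) =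
        {Set.range fun k : ℕ => (S a b)^[k] u, Set.range fun k : ℕ => (S a b)^[k] v} := by
      apply Set.Subset.antisymm
      · rintro _ ⟨x, hx, rfl⟩
        by_cases h : (Set.range fun k : ℕ => (S a b)^[k] x) = Set.range fun k : ℕ => (S a b)^[k] u
        · exact Or.inl h
        · exact Or.inr (h3 x hx h)
      · rintro _ (rfl | rfl)
        exacts [hmem u hu, hmem v hv]
    -- Otherwise `T^q` is the identity, every direction is periodic, and the circle is a union of
    -- two finite orbits.
    have hl1 : l ≠ 1 := by
      intro h
      have hinf : Infinite Circle := Circle.argEquiv.infinite_iff.mpr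
        (Set.Ioc.infinite (by linarith [Real.pi_pos]))
      refine Set.infinite_univ (α := Circle)
        (((orbit_finite hq (hSq hu)).union (orbit_finite hq (hSq hv))).subset fun x _ => ?_)
      exact htwo x (mem_periodicPts_of_multiplier hq one_pos (by rw [one_smul, hid h]))
    rcases lt_or_gt_of_ne hl1 with h | h
    · have hm1 : 1 < m := by nlinarith
      exact ⟨_, _, hvu, by rw [horb, Set.pair_comm],
        two_orbits hF hq hτ hm1 hl h hmv hlu rfl rfl fun x hx => (htwo x hx).symm⟩
    · have hm1 : m < 1 := by nlinarith
      exact ⟨_, _, hvu.symm, horb, two_orbits hF hq hτ h hm hm1 hlu hmv rfl rfl htwo⟩
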